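/- **Lemma 1 (Hierarchical Covering Lemma).** Let $K\ge 1$, $\mathcal K=\{1,\dots,K\}$, and let $\mathbb A$ be the set of nonempty subsets of $\mathcal K$; write $\mathbb A^{l}=\{S\in\mathbb A:|S|=l\}$, $\mathbb A^{(l+1):K}=\{S\in\mathbb A:|S|>l\}$, and $\mathbb A(S)\setminus S=\{T\in\mathbb A: T\supsetneq S\}$. Let $U(\mathbb A)=(U_S)_{S\in\mathbb A}$ be random variables with finite alphabets and joint pmf $p$; for $\mathcal J\subseteq\mathbb A$ put $U(\mathcal J)=(U_S)_{S\in\mathcal J}$. Entropies are in bits. A sequence $x^n$ is $\epsilon$-typical for a pmf $q$, written $x^n\in\mathcal T^{(n)}_\epsilon$, if $|\pi(x\mid x^n)-q(x)|\le\epsilon\, q(x)$ for every symbol $x$, where $\pi(\cdot\mid x^n)$ is the empirical pmf of $x^n$; joint typicality of a tuple of sequences is typicality of the sequence of tuples. Then there is a function $\delta:(0,\infty)\to(0,\infty)$, depending only on $p$, with $\delta(\epsilon)\to0$ as $\epsilon\to0$, such that the following holds. Let $0<\epsilon_K<\epsilon_{K-1}<\dots<\epsilon_1$, let $r_S\in\mathbb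 R$ for $S\in\mathbb A$, $S\ne\mathcal K$, and for each $n$ let $U^n_{\mathcal K}$ be a random sequence with $\lim_{n\to\infty}P\{U^n_{\mathcal K}\in\mathcal T^{(n)}_{\epsilon_K}\}=1$. For each $n$ let random codewords $U_S^n(m_S)$, $m_S\in[1:2^{nr_S}]=\{1,\dots,2^{\lceil nr_S\rceil}\}$, $S\in\mathbb A$, $S\ne\mathcal K$, be given, generated level by level for $l=K-1,\dots,1$; the codeword $U_S^n(m_S)$ of a set with $|S|=l$ may, besides $m_S$, depend on the choice of the indices of the levels $l+1,\dots,K-1$ (there is such a codeword for each choice of these indices). Assume that for every $l\in[1:K-1]$ and every choice of the indices of the levels above $l$, conditionally on all codewords of the levels $l+1,\dots,K$: 1. each $U^n_S(m_S)$, $S\in\mathbb A^l$, has the law $\prod_{i=1}^n p_{U_S\mid U(\mathbb A(S)\setminus S)}\big(u_{S,i}\mid u_{T,i}:T\supsetneq S\big)$, where $u_T^n$ are the codewords with the chosen indices (nothing is required where this conditional pmf is undefined); 2. for each $S\in\mathbb A^l$ the codewords $U_S^n(m_S)$, $m_S\in[1:2^{nr_S}]$, are pairwise independent; 3. the families $\big(U_S^n(m_S):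 m_S\in[1:2^{nr_S}]\big)$, $S\in\mathbb A^l$, are mutually independent. If $$\sum_{S\in\mathcal J}r_S>\sum_{S\in\mathcal J}H\big(U_S\mid U(\mathbb A(S)\setminus S)\big)-H\big(U(\mathcal J)\mid U(\mathbb A^{(l+1):K})\big)+\delta(\epsilon_l)$$ for all $l\in[1:K-1]$ and all nonempty $\mathcal J\subseteq\mathbb A^l$, then $$\lim_{n\to\infty}P\Big\{\big((U_S^n(m_S))_{S\in\mathbb A,\,S\neq\mathcal K},\,U^n_{\mathcal K}\big)\notin\mathcal T^{(n)}_{\epsilon_1}\ \text{for all } (m_S)_S\in\prod_{S\in\mathbb A,\,S\ne\mathcal K}[1:2^{nr_S}]\Big\}=0 .$$ -/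

import Mathlib

open MeasureTheory ProbabilityTheory Filter Topology

noncomputable section

namespace HierCov

/-! ### Information measures of discrete random variables under a pmf -/

/-- The conditional probability `P(f = b | g = c)` under the pmf `p`
(only meaningful when `P(g = c) > 0`). -/
def condProb {γ β β' : Type*} (p : PMF γ) (f : γ → β) (g : γ → β') (b : β) (c : β') : ℝ :=
  (p.map (fun u => (f u, g u)) (b, c)).toReal / (p.map g c).toReal

/-- The conditional entropy `H(f | g)` in bits,
`- ∑_{b,c} P(f = b, g = c) log₂ P(f = b | g = c)`. -/
def condEntropy {γ β β' : Type*} [Fintype β] [Fintype β'] (p : PMF γ)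
    (f : γ → β) (g : γ → β') : ℝ :=
  -∑ b, ∑ c, (p.map (fun u => (f u, g u)) (b, c)).toReal * Real.logb 2 (condProb p f g b c)

open Classical in
/-- `x^n` is (robustly) `ε`-typical for the pmf `q`: its empirical pmf satisfies
`|π(b | x^n) - q(b)| ≤ ε q(b)` for every symbol `b`. -/
def Typical {β : Type*} (q : PMF β) (ε : ℝ) {n : ℕ} (x : Fin n → β) : Prop :=
  ∀ b, |((Finset.univ.filter fun i => x i = b).card : ℝ) / n - (q b).toReal|
    ≤ ε * (q b).toReal

/-! ### The index sets -/

/-- The nonempty subsets of `{1, …, K}`. -/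
abbrev Sets (K : ℕ) : Type := {S : Finset (Fin K) // S.Nonempty}

/-- The whole set `{1, …, K}`. -/
def whole (K : ℕ) [NeZero K] : Sets K := ⟨Finset.univ, Finset.univ_nonempty⟩

/-- The sets of cardinality `l`. -/
def level (K l : ℕ) : Finset (Sets K) := Finset.univ.filter fun S => S.1.card = l

/-- The sets of cardinality `l + 1, …, K`. -/
def upper (K l : ℕ) : Finset (Sets K) := Finset.univ.filter fun S => l < S.1.card

/-- The proper supersets of `S`. -/
def above {K : ℕ} (S : Sets K) : Finset (Sets K) := Finset.univ.filter fun T => S.1 ⊂ T.1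

/-! ### Random hierarchical codebooks -/

/-- The number of codewords of the set `S` at block length `n`: a single one for the whole set,
and `|[1 : 2^{n r_S}]| = 2^⌈n r_S⌉` for a proper subset. -/
def numWords {K : ℕ} (r : Sets K → ℝ) (n : ℕ) (S : Sets K) : ℕ :=
  if S.1 = Finset.univ then 1 else 2 ^ ⌈(n : ℝ) * r S⌉₊

/-- The index tuples `(m_S)_S`. -/
abbrev Index {K : ℕ} (r : Sets K → ℝ) (n : ℕ) : Type :=
  ∀ S : Sets K, Fin (numWords r n S)

/-- The event that all codewords of the levels above `l` take the same values as at `ω`.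
These events are the atoms on which one conditions when codewords of level `l` are generated. -/
def sameAbove {K : ℕ} {α : Sets K → Type*} {r : Sets K → ℝ} {n : ℕ} {Ω : Type*}
    (U : ∀ S : Sets K, Index r n → Ω → Fin n → α S) (l : ℕ) (ω : Ω) : Set Ω :=
  {ω' | ∀ T : Sets K, l < T.1.card → ∀ m, U T m ω' = U T m ω}

/-- `U S m` is the codeword `U_S^n(m_S)` that belongs to the choice `m` of indices. Besides `m_S`
it may depend on the indices of the codewords of higher levels given which it is generated
(as in superposition coding), but on no other index. -/
structure IsCodebook {K : ℕ} [NeZero K] {α : Sets K → Type*}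
    [∀ S, MeasurableSpace (α S)] (p : PMF (∀ S, α S)) (r : Sets K → ℝ) {n : ℕ}
    {Ω : Type*} [MeasurableSpace Ω] (μ : Measure Ω)
    (UK : Ω → Fin n → α (whole K))
    (U : ∀ S : Sets K, Index r n → Ω → Fin n → α S) : Prop where
  measurable : ∀ S m, Measurable (U S m)
  /-- The codeword of the whole set is the given random sequence. -/
  top : ∀ m, U (whole K) m = UK
  /-- The codeword of `S` is determined by the index of `S` and the indices of higher levels. -/
  index : ∀ S (m m' : Index r n), m S = m' S →
    (∀ T : Sets K, S.1.card < T.1.card → m T = m' T) → U S m = U S m'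
  /-- Given the codewords of higher levels, a codeword of `S` has the law
  `∏_i p(u_{S,i} | u_{S',i} : S' ⊋ S)`, wherever this conditional pmf is defined. -/
  law : ∀ S, S ≠ whole K → ∀ (m : Index r n) (ω : Ω), μ (sameAbove U S.1.card ω) ≠ 0 →
    (∀ i, p.map (above S).restrict (fun T => U T.1 m ω i) ≠ 0) →
    ∀ x : Fin n → α S,
      (μ[|sameAbove U S.1.card ω]).real {ω' | U S m ω' = x} =
        ∏ i, condProb p (fun u => u S) (above S).restrict (x i) (fun T => U T.1 m ω i)
  /-- Given the codewords of higher levels, the codewords of `S` are pairwise independent. -/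
  pairwise : ∀ S, S ≠ whole K → ∀ (m : Index r n) (ω : Ω), μ (sameAbove U S.1.card ω) ≠ 0 →
    ∀ a b : Fin (numWords r n S), a ≠ b →
      IndepFun (U S (Function.update m S a)) (U S (Function.update m S b))
        (μ[|sameAbove U S.1.card ω])
  /-- Given the codewords of higher levels, the families of codewords of the different sets of one
  level are mutually independent. -/
  mutual_indep : ∀ l, 1 ≤ l → l < K → ∀ (m : Index r n) (ω : Ω), μ (sameAbove U l ω) ≠ 0 →
    iIndepFun
      (fun (S : level K l) (ω' : Ω) (a : Fin (numWords r n S.1)) =>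
        U S.1 (Function.update m S.1 a) ω')
      (μ[|sameAbove U l ω])

end HierCov

end

noncomputable section

namespace HierCov

/-! ### Finite pmfs and means -/

/-! The levels are treated from the top down. The event `uncovered p U l ε` says that no index
choice makes the codewords of cardinality above `l` jointly typical. For `l = K - 1` only the given
sequence is involved, so its probability tends to zero by assumption.
`IsCodebook.measureReal_uncovered_le` adds one level: passing from `l` to `l - 1`, and from
tolerance `ε (l + 1)` to the larger `ε l`, costs a vanishing additional probability. At `l = 0`
every set is included.

For one level, condition on all codewords above it. On an atom where some index choice yields a
typical tuple `c`, fix one such choice; no union bound over choices is needed. The codewords of the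
level are then independent families of pairwise independent sequences with product laws given `c`,
and what remains is the conditional mutual covering lemma `exists_covering_bound`.

That lemma is a second moment argument. Let `Z` count the index tuples whose codewords are jointly
typical with `c`. In the second moment, pairs of tuples are grouped by the set `D` of positions
where their indices agree; empty `D` contributes at most the squared mean, and Chebyshev's
inequality leaves a sum over nonempty `D` (`measureReal_forall_not_le`). Each term compares the
probability that one tuple is typical with the probability that the positions outside `D` complete a
typical tuple. Both are estimated by a change of measure from the product of kernels to the true
conditional law (`prod_kernel_eq`): on typical sequences the density is exponential, with rate known
up to a multiple of `ε`. Conditional typicality bounds the first probability from below, and total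
mass at most one bounds the second from above. By the chain rule (`mean_logRatio_sub`) the net
exponent for `D` is the excess in the rate condition for `D`, up to `ε * slack`, and `δ` is chosen
to dominate this error for all levels and all `D`. -/

open Classical in
lemma toReal_map_apply {γ β : Type*} [Fintype γ] (p : PMF γ) (f : γ → β) (b : β) :
    (p.map f b).toReal = ∑ u, if f u = b then (p u).toReal else 0 := by
  rw [PMF.map_apply, tsum_fintype, ENNReal.toReal_sum]
  · refine Finset.sum_congr rfl fun u _ => ?_
    by_cases h : f u = b
    · simp [h]
    · simp [h, Ne.symm h]
  · intro u _
    split_ifs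
    · exact p.apply_ne_top u
    · exact ENNReal.zero_ne_top

/-- The mean of `g` under the pmf `p`. -/
def mean {γ : Type*} [Fintype γ] (p : PMF γ) (g : γ → ℝ) : ℝ := ∑ u, (p u).toReal * g u

lemma mean_map {γ β : Type*} [Fintype γ] [Fintype β] (p : PMF γ) (f : γ → β) (g : β → ℝ) :
    mean (p.map f) g = mean p (fun u => g (f u)) := by
  classical
  unfold mean
  simp_rw [toReal_map_apply, Finset.sum_mul]
  rw [Finset.sum_comm]
  refine Finset.sum_congr rfl fun u _ => ?_
  simp [ite_mul]

lemma mean_congr {γ : Type*} [Fintype γ] (p : PMF γ) {g h : γ → ℝ}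
    (H : ∀ u, p u ≠ 0 → g u = h u) : mean p g = mean p h := by
  refine Finset.sum_congr rfl fun u _ => ?_
  by_cases hu : p u = 0
  · simp [hu]
  · rw [H u hu]

lemma mean_sub {γ : Type*} [Fintype γ] (p : PMF γ) (g h : γ → ℝ) :
    mean p (fun u => g u - h u) = mean p g - mean p h := by
  simp [mean, mul_sub]

lemma mean_sum {γ ι : Type*} [Fintype γ] (p : PMF γ) (s : Finset ι) (g : ι → γ → ℝ) :
    mean p (fun u => ∑ i ∈ s, g i u) = ∑ i ∈ s, mean p (g i) := by
  simp only [mean, Finset.mul_sum]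
  exact Finset.sum_comm

lemma mean_nonneg {γ : Type*} [Fintype γ] (p : PMF γ) {g : γ → ℝ} (hg : ∀ u, 0 ≤ g u) :
    0 ≤ mean p g :=
  Finset.sum_nonneg fun u _ => mul_nonneg ENNReal.toReal_nonneg (hg u)

lemma toReal_pos_of_ne_zero {γ : Type*} (p : PMF γ) {u : γ} (h : p u ≠ 0) : 0 < (p u).toReal :=
  ENNReal.toReal_pos h (p.apply_ne_top u)

lemma map_apply_ne_zero {γ β : Type*} (p : PMF γ) (f : γ → β) {u : γ} (h : p u ≠ 0) :
    p.map f (f u) ≠ 0 := by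
  rw [← PMF.mem_support_iff, PMF.mem_support_map_iff]
  exact ⟨u, (PMF.mem_support_iff _ _).2 h, rfl⟩

lemma condEntropy_eq_mean {γ β β' : Type*} [Fintype γ] [Fintype β] [Fintype β'] (p : PMF γ)
    (f : γ → β) (g : γ → β') :
    condEntropy p f g = -mean p (fun u => Real.logb 2 (condProb p f g (f u) (g u))) := by
  unfold condEntropy
  rw [← mean_map p (fun u => (f u, g u)) (fun x => Real.logb 2 (condProb p f g x.1 x.2))]
  rw [mean, Fintype.sum_prod_type]

lemma condProb_pos {γ β β' : Type*} (p : PMF γ) (f : γ → β) (g : γ → β') {u : γ} (h : p u ≠ 0) :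
    0 < condProb p f g (f u) (g u) :=
  div_pos (toReal_pos_of_ne_zero _ (map_apply_ne_zero p (fun u => (f u, g u)) h))
    (toReal_pos_of_ne_zero _ (map_apply_ne_zero p g h))

lemma condProb_map {δ γ β β' : Type*} (p : PMF δ) (φ : δ → γ) (f : γ → β) (g : γ → β')
    (b : β) (c : β') :
    condProb (p.map φ) f g b c = condProb p (fun u => f (φ u)) (fun u => g (φ u)) b c := by
  unfold condProb
  rw [PMF.map_comp, PMF.map_comp]
  rfl

/-- The conditional probability of the atom of `f` at `u` depends only on that atom. -/
lemma condProb_congr {γ β β₁ β' : Type*} [Fintype γ] (p : PMF γ) (f : γ → β) (f₁ : γ → β₁)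
    (g : γ → β') (u : γ) (h : ∀ v, f v = f u ↔ f₁ v = f₁ u) :
    condProb p f g (f u) (g u) = condProb p f₁ g (f₁ u) (g u) := by
  classical
  unfold condProb
  simp only [toReal_map_apply, Prod.mk.injEq, h]

/-! ### Typical sequences -/

open Classical in
lemma sum_comp_eq_sum_card {β : Type*} [Fintype β] {n : ℕ} (x : Fin n → β) (g : β → ℝ) :
    ∑ i, g (x i) = ∑ b, ((Finset.univ.filter fun i => x i = b).card : ℝ) * g b := by
  rw [← Finset.sum_fiberwise_of_maps_to (g := x) (t := Finset.univ) (fun _ _ => Finset.mem_univ _)]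
  refine Finset.sum_congr rfl fun b _ => ?_
  rw [Finset.sum_congr rfl (g := fun _ => g b)]
  · simp
  · intro i hi
    rw [(Finset.mem_filter.1 hi).2]

/-- Since the tolerance for each symbol is proportional to its probability, the symbolwise errors
add up to a multiple of the mean of `|g|`. This turns sums of log-likelihoods into deterministic
exponents. -/
lemma Typical.abs_sum_sub_le {β : Type*} [Fintype β] {q : PMF β} {ε : ℝ} {n : ℕ} {x : Fin n → β}
    (hx : Typical q ε x) (g : β → ℝ) :
    |∑ i, g (x i) - n * mean q g| ≤ n * (ε * mean q (fun b => |g b|)) := by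
  classical
  rcases Nat.eq_zero_or_pos n with rfl | hn
  · simp
  have hn' : (0 : ℝ) < n := by exact_mod_cast hn
  rw [sum_comp_eq_sum_card, mean, mean, Finset.mul_sum, ← Finset.sum_sub_distrib, Finset.mul_sum,
    Finset.mul_sum]
  refine (Finset.abs_sum_le_sum_abs _ _).trans (Finset.sum_le_sum fun b _ => ?_)
  have h := hx b
  set N : ℝ := ((Finset.univ.filter fun i => x i = b).card : ℝ)
  have e : N * g b - n * ((q b).toReal * g b) = n * ((N / n - (q b).toReal) * g b) := by
    field_simp
  rw [e, abs_mul, abs_mul, abs_of_pos hn', ← mul_assoc ε]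
  gcongr

/-- A relative tolerance leaves no room at symbols of mass zero, so they never occur. Hence
logarithms and conditional pmfs along typical sequences are genuine. -/
lemma Typical.apply_ne_zero {β : Type*} {q : PMF β} {ε : ℝ} {n : ℕ} {x : Fin n → β}
    (hx : Typical q ε x) (i : Fin n) : q (x i) ≠ 0 := by
  classical
  intro h0
  have h := hx (x i)
  rw [h0] at h
  simp only [ENNReal.toReal_zero, sub_zero, mul_zero, abs_nonpos_iff, div_eq_zero_iff,
    Nat.cast_eq_zero, Finset.card_eq_zero] at h
  rcases h with h | h
  · have : i ∈ (Finset.univ.filter fun j => x j = x i) := by simp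
    rw [Finset.filter_congr_decidable] at *
    exact absurd (h ▸ this) (by simp)
  · exact (Fin.pos i).ne' h

-- The indicator of a fibre is its own absolute value, so the averaging bound applied to it loses
-- nothing in `ε`.
open Classical in
lemma Typical.map {β β' : Type*} [Fintype β] {q : PMF β} {ε : ℝ} {n : ℕ} {x : Fin n → β}
    (hx : Typical q ε x) (f : β → β') : Typical (q.map f) ε (fun i => f (x i)) := by
  intro c
  have h := hx.abs_sum_sub_le (fun b => if f b = c then (1 : ℝ) else 0)
  have e1 : mean q (fun b => if f b = c then (1 : ℝ) else 0) = (q.map f c).toReal := by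
    rw [toReal_map_apply]
    simp [mean]
  have e2 : mean q (fun b => |if f b = c then (1 : ℝ) else 0|) = (q.map f c).toReal := by
    rw [← e1]
    congr 1
    ext b
    split_ifs <;> simp
  have e3 : ∑ i, (if f (x i) = c then (1 : ℝ) else 0)
      = ((Finset.univ.filter fun i => f (x i) = c).card : ℝ) := by
    simp
  rw [e1, e2, e3] at h
  -- For `n = 0` the averaging bound is void, while all frequencies are `0` by the convention for
  -- division; the symbolwise bounds are summed instead.
  rcases Nat.eq_zero_or_pos n with rfl | hn
  · simp only [toReal_map_apply, Finset.mul_sum, CharP.cast_eq_zero, div_zero, zero_sub, abs_neg]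
    refine (Finset.abs_sum_le_sum_abs _ _).trans (Finset.sum_le_sum fun u _ => ?_)
    have hu := hx u
    simp only [CharP.cast_eq_zero, div_zero, zero_sub, abs_neg] at hu
    split_ifs
    · exact hu
    · simp
  have hn' : (0 : ℝ) < n := by exact_mod_cast hn
  set N : ℝ := ((Finset.univ.filter fun i => f (x i) = c).card : ℝ)
  have e : N / n - (q.map f c).toReal = (N - n * (q.map f c).toReal) / n := by field_simp
  rw [e, abs_div, abs_of_pos hn', div_le_iff₀ hn']
  linarith

/-! ### Conditional typicality -/

lemma sum_prod_pi {n : ℕ} {B : Type*} [Fintype B] (w : Fin n → B → ℝ) :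
    ∑ y : Fin n → B, ∏ i, w i (y i) = ∏ i, ∑ b, w i b := by
  classical
  rw [Finset.prod_univ_sum, Fintype.piFinset_univ]

/-- The variance of a sum of `n` independent centred variables bounded by `1` is at most `n`. -/
lemma sum_prod_mul_sq_le {n : ℕ} {B : Type*} [Fintype B] (w h : Fin n → B → ℝ)
    (hw : ∀ i b, 0 ≤ w i b) (hw1 : ∀ i, ∑ b, w i b = 1) (hh : ∀ i b, |h i b| ≤ 1)
    (hh0 : ∀ i, ∑ b, w i b * h i b = 0) :
    ∑ y : Fin n → B, (∏ i, w i (y i)) * (∑ i, h i (y i)) ^ 2 ≤ n := by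
  classical
  have key : ∀ i j : Fin n, ∑ y : Fin n → B, (∏ k, w k (y k)) * (h i (y i) * h j (y j))
      ≤ if i = j then 1 else 0 := by
    intro i j
    by_cases hij : i = j
    · subst hij
      rw [if_pos rfl]
      calc ∑ y : Fin n → B, (∏ k, w k (y k)) * (h i (y i) * h i (y i))
          ≤ ∑ y : Fin n → B, (∏ k, w k (y k)) := by
            refine Finset.sum_le_sum fun y _ => ?_
            refine mul_le_of_le_one_right (Finset.prod_nonneg fun k _ => hw _ _) ?_
            rw [← abs_mul_abs_self]
            exact mul_le_one₀ (hh _ _) (abs_nonneg _) (hh _ _)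
        _ = 1 := by rw [sum_prod_pi]; simp [hw1]
    -- Off the diagonal the expectation factors over coordinates, and the factor at `i` is a centred
    -- mean.
    · rw [if_neg hij]
      have e : ∀ y : Fin n → B, (∏ k, w k (y k)) * (h i (y i) * h j (y j))
          = ∏ k, (w k (y k) * ((if k = i then h k (y k) else 1) *
              (if k = j then h k (y k) else 1))) := by
        intro y
        rw [Finset.prod_mul_distrib, Finset.prod_mul_distrib, Finset.prod_ite_eq' Finset.univ i
          (fun k => h k (y k)), Finset.prod_ite_eq' Finset.univ j (fun k => h k (y k))]
        simp
      simp_rw [e]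
      rw [sum_prod_pi (fun k b => w k b * ((if k = i then h k b else 1) *
              (if k = j then h k b else 1)))]
      refine (Finset.prod_eq_zero (Finset.mem_univ i) ?_).le
      simp [hij, hh0]
  calc ∑ y : Fin n → B, (∏ i, w i (y i)) * (∑ i, h i (y i)) ^ 2
      = ∑ i, ∑ j, ∑ y : Fin n → B, (∏ k, w k (y k)) * (h i (y i) * h j (y j)) := by
        simp_rw [sq, Finset.sum_mul_sum, Finset.mul_sum]
        rw [Finset.sum_comm]
        refine Finset.sum_congr rfl fun i _ => ?_
        rw [Finset.sum_comm]
    _ ≤ ∑ i : Fin n, ∑ j : Fin n, if i = j then (1 : ℝ) else 0 :=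
        Finset.sum_le_sum fun i _ => Finset.sum_le_sum fun j _ => key i j
    _ = n := by simp

open Classical in
/-- The conditional pmf of a symbol under `q` given the value `c` of `f`. -/
def condMass {B C : Type*} (q : PMF B) (f : B → C) (c : C) (b : B) : ℝ :=
  if f b = c then (q b).toReal / (q.map f c).toReal else 0

lemma condMass_nonneg {B C : Type*} (q : PMF B) (f : B → C) (c : C) (b : B) :
    0 ≤ condMass q f c b := by
  unfold condMass
  split_ifs
  · positivity
  · rfl

lemma sum_condMass {B C : Type*} [Fintype B] (q : PMF B) (f : B → C) {c : C}
    (hc : q.map f c ≠ 0) : ∑ b, condMass q f c b = 1 := by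
  classical
  have e : ∀ b, condMass q f c b =
      (if f b = c then (q b).toReal else 0) / (q.map f c).toReal := by
    intro b
    unfold condMass
    split_ifs <;> simp
  simp_rw [e]
  rw [← Finset.sum_div, ← toReal_map_apply, div_self (toReal_pos_of_ne_zero _ hc).ne']

open Classical in
/-- Chebyshev's inequality for the number of occurrences of the symbol `b₀`. -/
lemma sum_condMass_atypical_symbol_le {B C : Type*} [Fintype B] (q : PMF B) (f : B → C)
    {ε ε' : ℝ} (hε : ε' < ε) {n : ℕ} (hn : 0 < n) (c : Fin n → C)
    (hc : Typical (q.map f) ε' c) (b₀ : B) :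
    ∑ y : Fin n → B with ¬ |((Finset.univ.filter fun i => y i = b₀).card : ℝ) / n - (q b₀).toReal|
      ≤ ε * (q b₀).toReal, ∏ i, condMass q f (c i) (y i)
      ≤ (1 / ((ε - ε') * (q b₀).toReal) ^ 2) / n := by
  have hn' : (0 : ℝ) < n := by exact_mod_cast hn
  -- If `b₀` has mass zero, sequences of positive weight avoid it and satisfy the frequency bound
  -- exactly; the right-hand side is `0` by the convention for division.
  by_cases hb : q b₀ = 0
  · refine (Finset.sum_nonpos fun y hy => ?_).trans (by positivity)
    refine (?_ : _ = (0 : ℝ)).le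
    by_contra hne
    apply (Finset.mem_filter.1 hy).2
    have : (Finset.univ.filter fun i => y i = b₀) = ∅ := by
      rw [Finset.filter_eq_empty_iff]
      intro i _ hi
      refine hne (Finset.prod_eq_zero (Finset.mem_univ i) ?_)
      simp [condMass, hi, hb]
    simp [this, hb]
  have hq : 0 < (q b₀).toReal := toReal_pos_of_ne_zero _ hb
  set w : Fin n → B → ℝ := fun i => condMass q f (c i)
  set h : Fin n → B → ℝ := fun i b => (if b = b₀ then 1 else 0) - w i b₀
  have hw : ∀ i b, 0 ≤ w i b := fun i b => condMass_nonneg _ _ _ _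
  have hw1 : ∀ i, ∑ b, w i b = 1 := fun i => sum_condMass q f (hc.apply_ne_zero i)
  have hle : ∀ i, w i b₀ ≤ 1 := fun i => by
    rw [← hw1 i]
    exact Finset.single_le_sum (fun b _ => hw i b) (Finset.mem_univ b₀)
  have hV := sum_prod_mul_sq_le w h hw hw1
    (fun i b => by
      have := hw i b₀
      have := hle i
      simp only [h]
      rw [abs_le]
      split_ifs <;> constructor <;> linarith)
    (fun i => by simp [h, mul_sub, ← Finset.sum_mul, hw1])
  have hd : 0 < (ε - ε') * (q b₀).toReal := mul_pos (by linarith) hq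
  set d := (ε - ε') * (q b₀).toReal
  -- The conditional mean count of `b₀` is a fixed multiple of the number of occurrences of `f b₀`
  -- in `c`, so it inherits the tolerance `ε'`. The remaining `ε - ε'` must come from random
  -- fluctuation.
  have hsumw : |∑ i, w i b₀ - n * (q b₀).toReal| ≤ n * (ε' * (q b₀).toReal) := by
    have h1 := hc (f b₀)
    have hQ : 0 < (q.map f (f b₀)).toReal := toReal_pos_of_ne_zero _ (map_apply_ne_zero q f hb)
    set Q := (q.map f (f b₀)).toReal
    set N : ℝ := ((Finset.univ.filter fun i => c i = f b₀).card : ℝ)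
    have e : ∑ i, w i b₀ = N * ((q b₀).toReal / Q) := by
      have : ∀ i, w i b₀ = if c i = f b₀ then (q b₀).toReal / Q else 0 := by
        intro i
        simp only [w, condMass]
        by_cases hi : c i = f b₀
        · rw [if_pos hi.symm, if_pos hi, hi]
        · rw [if_neg (Ne.symm hi), if_neg hi]
      simp_rw [this]
      rw [← Finset.sum_filter]
      simp [N]
    have e2 : ∑ i, w i b₀ - n * (q b₀).toReal = n * ((N / n - Q) * ((q b₀).toReal / Q)) := by
      rw [e]
      field_simp
    rw [e2, abs_mul, abs_mul, abs_of_pos hn', abs_of_pos (div_pos hq hQ)]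
    calc n * (|N / n - Q| * ((q b₀).toReal / Q)) ≤ n * (ε' * Q * ((q b₀).toReal / Q)) := by gcongr
      _ = _ := by field_simp
  have hlow : ∀ y : Fin n → B, (¬ |((Finset.univ.filter fun i => y i = b₀).card : ℝ) / n
      - (q b₀).toReal| ≤ ε * (q b₀).toReal) → (n * d) ^ 2 ≤ (∑ i, h i (y i)) ^ 2 := by
    intro y hy
    rw [not_le] at hy
    set N : ℝ := ((Finset.univ.filter fun i => y i = b₀).card : ℝ)
    have e : ∑ i, h i (y i) = N - ∑ i, w i b₀ := by
      simp [h, N]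
    have e3 : N / n - (q b₀).toReal = (N - n * (q b₀).toReal) / n := by field_simp
    rw [e3, abs_div, abs_of_pos hn', lt_div_iff₀ hn'] at hy
    have t : |N - n * (q b₀).toReal| ≤ |∑ i, h i (y i)| + |∑ i, w i b₀ - n * (q b₀).toReal| := by
      rw [e]
      refine le_trans (le_of_eq ?_) (abs_add_le _ _)
      congr 1
      ring
    refine sq_le_sq' ?_ ?_ |>.trans (sq_abs _).le
    · have := abs_nonneg (∑ i, h i (y i))
      have := mul_pos hn' hd
      linarith
    · simp only [d]
      nlinarith
  have hpos : 0 < (n * d) ^ 2 := by positivity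
  have main : (n * d) ^ 2 * ∑ y : Fin n → B with ¬ |((Finset.univ.filter fun i => y i = b₀).card : ℝ)
      / n - (q b₀).toReal| ≤ ε * (q b₀).toReal, ∏ i, w i (y i) ≤ n := by
    refine le_trans ?_ hV
    rw [Finset.mul_sum]
    refine le_trans (Finset.sum_le_sum (g := fun y => (∏ i, w i (y i)) * (∑ i, h i (y i)) ^ 2)
      fun y hy => ?_) (Finset.sum_le_sum_of_subset_of_nonneg (Finset.subset_univ _) fun y _ _ => ?_)
    · rw [mul_comm]
      exact mul_le_mul_of_nonneg_left (hlow y (Finset.mem_filter.1 hy).2)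
        (Finset.prod_nonneg fun i _ => hw _ _)
    · exact mul_nonneg (Finset.prod_nonneg fun i _ => hw _ _) (sq_nonneg _)
  rw [mul_comm, ← le_div_iff₀ hpos] at main
  refine main.trans (le_of_eq ?_)
  field_simp

open Classical in
/-- Conditional typicality lemma: if `c` is typical for the law of `f` under `q`, then a sequence
drawn from the conditional law given `c` is typical for `q` with probability at least `1 / 2`. -/
lemma eventually_half_le_sum_condMass {B C : Type*} [Fintype B] (q : PMF B) (f : B → C)
    {ε ε' : ℝ} (hε : ε' < ε) :
    ∀ᶠ n : ℕ in atTop, ∀ c : Fin n → C, Typical (q.map f) ε' c →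
      1 / 2 ≤ ∑ y : Fin n → B with Typical q ε y, ∏ i, condMass q f (c i) (y i) := by
  set A : ℝ := ∑ b, 1 / ((ε - ε') * (q b).toReal) ^ 2
  have ht : Tendsto (fun n : ℕ => A / (n : ℝ)) atTop (𝓝 0) := tendsto_const_div_atTop_nhds_zero_nat A
  filter_upwards [ht.eventually (ge_mem_nhds (show (0 : ℝ) < 1 / 2 by norm_num)),
    eventually_gt_atTop 0] with n hn hn0 c hc
  have h1 : ∑ y : Fin n → B, ∏ i, condMass q f (c i) (y i) = 1 := by
    rw [sum_prod_pi fun i => condMass q f (c i)]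
    exact Finset.prod_eq_one fun i _ => sum_condMass q f (hc.apply_ne_zero i)
  rw [← Finset.sum_filter_add_sum_filter_not Finset.univ (fun y => Typical q ε y)] at h1
  have h2 : ∑ y : Fin n → B with ¬ Typical q ε y, ∏ i, condMass q f (c i) (y i) ≤ A / n := by
    have hnn : ∀ y : Fin n → B, 0 ≤ ∏ i, condMass q f (c i) (y i) :=
      fun y => Finset.prod_nonneg fun i _ => condMass_nonneg _ _ _ _
    calc ∑ y : Fin n → B with ¬ Typical q ε y, ∏ i, condMass q f (c i) (y i)
        ≤ ∑ b, ∑ y : Fin n → B with ¬ |((Finset.univ.filter fun i => y i = b).card : ℝ) / n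
            - (q b).toReal| ≤ ε * (q b).toReal, ∏ i, condMass q f (c i) (y i) := by
          simp_rw [Finset.sum_filter]
          rw [Finset.sum_comm]
          refine Finset.sum_le_sum fun y _ => ?_
          split_ifs with hy
          · exact Finset.sum_nonneg fun b _ => by split_ifs <;> simp [hnn y]
          · unfold Typical at hy
            push Not at hy
            obtain ⟨b, hb⟩ := hy
            refine le_trans (le_of_eq ?_) (Finset.single_le_sum
              (fun b _ => by split_ifs <;> simp [hnn y]) (Finset.mem_univ b))
            rw [if_pos (not_le.2 hb)]
      _ ≤ ∑ b, (1 / ((ε - ε') * (q b).toReal) ^ 2) / n :=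
          Finset.sum_le_sum fun b _ => sum_condMass_atypical_symbol_le q f hε hn0 c hc b
      _ = A / n := by rw [Finset.sum_div]
  linarith

/-! ### The second moment method for independent families of codewords -/

open Classical in
/-- If `Z` counts the events `A a` that occur, Chebyshev's inequality bounds the probability that
none of them occurs. -/
lemma sq_mul_measureReal_forall_notMem_le {Ω κ : Type*} [MeasurableSpace Ω] [Fintype κ]
    (ν : Measure Ω) [IsProbabilityMeasure ν] (A : κ → Set Ω) (hA : ∀ a, MeasurableSet (A a)) :
    (∑ a, ν.real (A a)) ^ 2 * ν.real {ω | ∀ a, ω ∉ A a}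
      ≤ (∑ a, ∑ b, ν.real (A a ∩ A b)) - (∑ a, ν.real (A a)) ^ 2 := by
  set m := ∑ a, ν.real (A a)
  set Z : Ω → ℝ := fun ω => ∑ a, (A a).indicator 1 ω
  have hInd : ∀ s : Set Ω, MeasurableSet s → Integrable (s.indicator (1 : Ω → ℝ)) ν :=
    fun s hs => (integrable_const (1 : ℝ)).indicator hs
  have hZ : Integrable Z ν := integrable_finsetSum _ fun a _ => hInd _ (hA a)
  have hEZ : ∫ ω, Z ω ∂ν = m := by
    rw [integral_finsetSum _ fun a _ => hInd _ (hA a)]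
    exact Finset.sum_congr rfl fun a _ => integral_indicator_one (hA a)
  have hsq : ∀ ω, Z ω ^ 2 = ∑ a, ∑ b, (A a ∩ A b).indicator (1 : Ω → ℝ) ω := by
    intro ω
    simp only [Z, sq, Finset.sum_mul_sum, Set.inter_indicator_one, Pi.mul_apply]
  have hI2 : ∀ a, Integrable (fun ω => ∑ b, (A a ∩ A b).indicator (1 : Ω → ℝ) ω) ν :=
    fun a => integrable_finsetSum _ fun b _ => hInd _ ((hA a).inter (hA b))
  have hZ2 : Integrable (fun ω => Z ω ^ 2) ν := by
    simp_rw [hsq]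
    exact integrable_finsetSum _ fun a _ => hI2 a
  have hEZ2 : ∫ ω, Z ω ^ 2 ∂ν = ∑ a, ∑ b, ν.real (A a ∩ A b) := by
    simp_rw [hsq]
    rw [integral_finsetSum _ fun a _ => hI2 a]
    refine Finset.sum_congr rfl fun a _ => ?_
    rw [integral_finsetSum _ fun b _ => hInd _ ((hA a).inter (hA b))]
    exact Finset.sum_congr rfl fun b _ => integral_indicator_one ((hA a).inter (hA b))
  have hF : MeasurableSet {ω | ∀ a, ω ∉ A a} := by
    have : {ω | ∀ a, ω ∉ A a} = ⋂ a, (A a)ᶜ := by ext; simp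
    rw [this]
    exact MeasurableSet.iInter fun a => (hA a).compl
  have hvar : ∫ ω, (Z ω - m) ^ 2 ∂ν = (∑ a, ∑ b, ν.real (A a ∩ A b)) - m ^ 2 := by
    have e : ∀ ω, (Z ω - m) ^ 2 = Z ω ^ 2 - 2 * m * Z ω + m ^ 2 := fun ω => by ring
    simp_rw [e]
    rw [integral_add (f := fun ω => Z ω ^ 2 - 2 * m * Z ω) (hZ2.sub (hZ.const_mul _))
        (integrable_const _),
      integral_sub hZ2 (hZ.const_mul _), integral_const_mul, hEZ, hEZ2]
    simp
    ring
  rw [← hvar]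
  have hsqInt : Integrable (fun ω => (Z ω - m) ^ 2) ν := by
    have e : ∀ ω, (Z ω - m) ^ 2 = Z ω ^ 2 - 2 * m * Z ω + m ^ 2 := fun ω => by ring
    simp_rw [e]
    exact (hZ2.sub (hZ.const_mul _)).add (integrable_const _)
  rw [← integral_indicator_one hF, ← integral_const_mul]
  -- Where no event occurs, `Z = 0` and the squared deviation is exactly `m ^ 2`.
  refine integral_mono ((hInd _ hF).const_mul _) hsqInt fun ω => ?_
  by_cases hω : ω ∈ {ω | ∀ a, ω ∉ A a}
  · have : Z ω = 0 := Finset.sum_eq_zero fun a _ => Set.indicator_of_notMem (hω a) _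
    simp [Set.indicator_of_mem hω, this]
  · simp only [Set.indicator_of_notMem hω, mul_zero]
    positivity

open Classical in
/-- The joint law of two tuples of codewords, in terms of the set of sets on which their indices
agree. -/
lemma measureReal_pair_eq {Ω ι : Type*} [MeasurableSpace Ω] [Fintype ι]
    {E : ι → Type*} [∀ s, Fintype (E s)] [∀ s, MeasurableSpace (E s)]
    [∀ s, MeasurableSingletonClass (E s)] {M : ι → ℕ}
    (ν : Measure Ω) [IsProbabilityMeasure ν] (X : ∀ s, Fin (M s) → Ω → E s)
    (w : ∀ s, E s → ℝ) (hlaw : ∀ s a x, ν.real {ω | X s a ω = x} = w s x)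
    (hpair : ∀ s a b, a ≠ b → IndepFun (X s a) (X s b) ν)
    (hind : iIndepFun (fun s ω a => X s a ω) ν) (a b : ∀ s, Fin (M s)) (x y : ∀ s, E s) :
    ν.real {ω | (∀ s, X s (a s) ω = x s) ∧ ∀ s, X s (b s) ω = y s} =
      (∏ s, w s (x s)) * if ∀ s, a s = b s → y s = x s then
        ∏ s with a s ≠ b s, w s (y s) else 0 := by
  have h1 : {ω | (∀ s, X s (a s) ω = x s) ∧ ∀ s, X s (b s) ω = y s} =
      ⋂ s ∈ (Finset.univ : Finset ι), (fun ω a => X s a ω) ⁻¹'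
        {z : Fin (M s) → E s | z (a s) = x s ∧ z (b s) = y s} := by
    ext ω
    simp [forall_and]
  -- Equal indices force equal values; distinct indices factor by pairwise independence.
  have h2 : ∀ s, ν.real ((fun ω a => X s a ω) ⁻¹'
        {z : Fin (M s) → E s | z (a s) = x s ∧ z (b s) = y s}) =
      w s (x s) * if a s = b s then (if y s = x s then 1 else 0) else w s (y s) := by
    intro s
    have e : (fun ω a => X s a ω) ⁻¹' {z : Fin (M s) → E s | z (a s) = x s ∧ z (b s) = y s} =
        X s (a s) ⁻¹' {x s} ∩ X s (b s) ⁻¹' {y s} := rfl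
    rw [e]
    split_ifs with hab hxy
    · rw [← hab, hxy, Set.inter_self, mul_one]
      exact hlaw _ _ _
    · rw [← hab, mul_zero]
      convert measureReal_empty (μ := ν)
      ext ω
      simp only [Set.mem_inter_iff, Set.mem_preimage, Set.mem_singleton_iff, Set.mem_empty_iff_false,
        iff_false, not_and]
      intro h h'
      exact hxy (h'.symm.trans h)
    · have := (hpair s _ _ hab).measure_inter_preimage_eq_mul _ _
        (measurableSet_singleton (x s)) (measurableSet_singleton (y s))
      rw [measureReal_def, this, ENNReal.toReal_mul]
      congr 1
      · exact hlaw _ _ _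
      · exact hlaw _ _ _
  have h3 := hind.measure_inter_preimage_eq_mul Finset.univ
    (sets := fun s => {z : Fin (M s) → E s | z (a s) = x s ∧ z (b s) = y s})
    (fun s _ => by
      have ha : MeasurableSet ((fun z : Fin (M s) → E s => z (a s)) ⁻¹' {x s}) :=
        measurable_pi_apply (a s) (measurableSet_singleton (x s))
      have hb : MeasurableSet ((fun z : Fin (M s) → E s => z (b s)) ⁻¹' {y s}) :=
        measurable_pi_apply (b s) (measurableSet_singleton (y s))
      exact ha.inter hb)
  rw [measureReal_def, h1, h3, ENNReal.toReal_prod]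
  simp only [← measureReal_def, h2]
  rw [Finset.prod_mul_distrib]
  congr 1
  split_ifs with h
  · rw [Finset.prod_filter]
    refine Finset.prod_congr rfl fun s _ => ?_
    by_cases hs : a s = b s
    · simp [hs, h s hs]
    · simp [hs]
  · push Not at h
    obtain ⟨s, hs, hs'⟩ := h
    exact Finset.prod_eq_zero (Finset.mem_univ s) (by simp [hs, hs'])

open Classical in
/-- The number of index tuples that agree with `a` on `D`. -/
lemma card_agree_mul {ι : Type*} [Fintype ι] {M : ι → ℕ} (a : ∀ s, Fin (M s)) (D : Finset ι) :
    ((Finset.univ.filter fun b : ∀ s, Fin (M s) => ∀ s ∈ D, a s = b s).card : ℝ) *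
      ∏ s ∈ D, (M s : ℝ) = ∏ s, (M s : ℝ) := by
  have e : (Finset.univ.filter fun b : ∀ s, Fin (M s) => ∀ s ∈ D, a s = b s) =
      Fintype.piFinset fun s => if s ∈ D then {a s} else Finset.univ := by
    ext b
    simp only [Finset.mem_filter, Finset.mem_univ, true_and, Fintype.mem_piFinset]
    refine forall_congr' fun s => ?_
    by_cases hs : s ∈ D <;> simp [hs, eq_comm]
  rw [e, Fintype.card_piFinset, Nat.cast_prod,
    show ∏ s ∈ D, (M s : ℝ) = ∏ s, if s ∈ D then (M s : ℝ) else 1 by simp,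
    ← Finset.prod_mul_distrib]
  refine Finset.prod_congr rfl fun s _ => ?_
  by_cases hs : s ∈ D <;> simp [hs]

open Classical in
/-- Mutual covering bound: if the families `X s` are independent, with pairwise independent members
of law `w s`, then the probability that no tuple of codewords satisfies `τ` is small as soon as
the conditional probabilities `R D` of `τ` are small compared with `P ∏_{s ∈ D} M s`. -/
lemma measureReal_forall_not_le {Ω ι : Type*} [MeasurableSpace Ω] [Fintype ι]
    {E : ι → Type*} [∀ s, Fintype (E s)] [∀ s, MeasurableSpace (E s)]
    [∀ s, MeasurableSingletonClass (E s)] {M : ι → ℕ} (hM : ∀ s, 0 < M s)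
    (ν : Measure Ω) [IsProbabilityMeasure ν] (X : ∀ s, Fin (M s) → Ω → E s)
    (hX : ∀ s a, Measurable (X s a))
    (w : ∀ s, E s → ℝ) (hlaw : ∀ s a x, ν.real {ω | X s a ω = x} = w s x)
    (hpair : ∀ s a b, a ≠ b → IndepFun (X s a) (X s b) ν)
    (hind : iIndepFun (fun s ω a => X s a ω) ν) (τ : (∀ s, E s) → Prop) (P : ℝ) (hP : 0 < P)
    (hPτ : P ≤ ∑ x with τ x, ∏ s, w s (x s))
    (R : Finset ι → ℝ)
    (hR : ∀ D, D.Nonempty → ∀ x, τ x →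
      ∑ y with τ y ∧ ∀ s ∈ D, y s = x s, ∏ s with s ∉ D, w s (y s) ≤ R D) :
    ν.real {ω | ∀ a : ∀ s, Fin (M s), ¬ τ fun s => X s (a s) ω} ≤
      ∑ D : Finset ι with D.Nonempty, R D / (P * ∏ s ∈ D, (M s : ℝ)) := by
  have hw : ∀ s x, 0 ≤ w s x := by
    intro s x
    rw [← hlaw s ⟨0, hM s⟩ x]
    exact measureReal_nonneg
  set Q := ∑ x with τ x, ∏ s, w s (x s)
  have hQ : 0 < Q := hP.trans_le hPτ
  -- `Q > 0` provides some `x` with `τ x`, and `R D` dominates a sum of nonnegative terms at that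
  -- `x`.
  have hR0 : ∀ D : Finset ι, D.Nonempty → 0 ≤ R D := by
    intro D hD
    obtain ⟨x, hx⟩ : (Finset.univ.filter fun x => τ x).Nonempty := by
      by_contra h
      rw [Finset.not_nonempty_iff_eq_empty] at h
      simp [Q, h] at hQ
    exact (Finset.sum_nonneg fun y _ => Finset.prod_nonneg fun s _ => hw _ _).trans
      (hR D hD x (Finset.mem_filter.1 hx).2)
  let A : (∀ s, Fin (M s)) → Set Ω := fun a => {ω | τ fun s => X s (a s) ω}
  have hmeas1 : ∀ (a : ∀ s, Fin (M s)) (x : ∀ s, E s),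
      MeasurableSet {ω | ∀ s, X s (a s) ω = x s} := by
    intro a x
    have : {ω | ∀ s, X s (a s) ω = x s} = ⋂ s, X s (a s) ⁻¹' {x s} := by ext; simp
    rw [this]
    exact MeasurableSet.iInter fun s => hX s (a s) (measurableSet_singleton _)
  have hAeq : ∀ a, A a = ⋃ x ∈ Finset.univ.filter τ, {ω | ∀ s, X s (a s) ω = x s} := by
    intro a
    ext ω
    simp only [A, Set.mem_ofPred_eq, Finset.mem_filter, Finset.mem_univ, true_and, Set.mem_iUnion,
      exists_prop]
    constructor
    · exact fun h => ⟨_, h, fun s => rfl⟩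
    · rintro ⟨x, hx, h⟩
      have : (fun s => X s (a s) ω) = x := funext h
      rwa [this]
  have hA : ∀ a, MeasurableSet (A a) := by
    intro a
    rw [hAeq]
    exact Finset.measurableSet_biUnion _ fun x _ => hmeas1 a x
  have hAA : ∀ a b, ν.real (A a ∩ A b) = ∑ x with τ x, ∑ y with τ y,
      ν.real {ω | (∀ s, X s (a s) ω = x s) ∧ ∀ s, X s (b s) ω = y s} := by
    intro a b
    have hdisj : ∀ c : ∀ s, Fin (M s), Pairwise fun x y : ∀ s, E s =>
        Disjoint {ω | ∀ s, X s (c s) ω = x s} {ω | ∀ s, X s (c s) ω = y s} := by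
      intro c x y hxy
      rw [Set.disjoint_left]
      intro ω h1 h2
      exact hxy (funext fun s => (h1 s).symm.trans (h2 s))
    rw [hAeq a, Set.iUnion₂_inter, measureReal_biUnion_finset]
    · refine Finset.sum_congr rfl fun x _ => ?_
      rw [hAeq b, Set.inter_iUnion₂, measureReal_biUnion_finset]
      · rfl
      · exact fun y _ z _ hyz => (hdisj b hyz).mono Set.inter_subset_right Set.inter_subset_right
      · exact fun y _ => (hmeas1 a x).inter (hmeas1 b y)
    · exact fun y _ z _ hyz => (hdisj a hyz).mono Set.inter_subset_left Set.inter_subset_left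
    · exact fun y _ => (hmeas1 a y).inter (hA b)
  have hpairlaw := measureReal_pair_eq ν X w hlaw hpair hind
  have hA1 : ∀ a, ν.real (A a) = Q := by
    intro a
    rw [← Set.inter_self (A a), hAA]
    refine Finset.sum_congr rfl fun x hx => ?_
    simp_rw [hpairlaw]
    simp only [forall_true_left, ne_eq, not_true_eq_false, Finset.filter_false, Finset.prod_empty]
    rw [Finset.sum_eq_single x]
    · simp
    · intro y _ hyx
      rw [if_neg, mul_zero]
      exact fun h => hyx (funext h)
    · exact fun h => absurd hx h
  -- Only the exact agreement set matters, but summing over every nonempty `D` on which `a` and `b`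
  -- agree makes the later count of pairs a plain product.
  have hA2 : ∀ a b, ν.real (A a ∩ A b) ≤ Q ^ 2 +
      ∑ D : Finset ι with D.Nonempty, if ∀ s ∈ D, a s = b s then Q * R D else 0 := by
    intro a b
    have hterm : ∀ D ∈ Finset.univ.filter fun D : Finset ι => D.Nonempty,
        0 ≤ if ∀ s ∈ D, a s = b s then Q * R D else 0 := by
      intro D hD
      split_ifs
      · exact mul_nonneg hQ.le (hR0 D (Finset.mem_filter.1 hD).2)
      · rfl
    rw [hAA]
    simp_rw [hpairlaw]
    set D := Finset.univ.filter fun s => a s = b s with hDdef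
    by_cases hD : D.Nonempty
    · refine le_trans ?_ (add_le_add (sq_nonneg Q) (Finset.single_le_sum hterm
        (Finset.mem_filter.2 ⟨Finset.mem_univ D, hD⟩)))
      rw [if_pos (fun s hs => (Finset.mem_filter.1 hs).2), zero_add, Finset.sum_mul]
      refine Finset.sum_le_sum fun x hx => ?_
      rw [← Finset.mul_sum]
      refine mul_le_mul_of_nonneg_left ?_ (Finset.prod_nonneg fun s _ => hw _ _)
      refine le_trans (le_of_eq ?_) (hR D hD x (Finset.mem_filter.1 hx).2)
      rw [← Finset.filter_filter, Finset.sum_filter (p := fun y : ∀ s, E s => ∀ s ∈ D, y s = x s)]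
      simp [hDdef]
    · have hab : ∀ s, ¬ a s = b s := by
        intro s hs
        exact hD ⟨s, Finset.mem_filter.2 ⟨Finset.mem_univ _, hs⟩⟩
      refine le_trans (le_of_eq ?_) (le_add_of_nonneg_right (Finset.sum_nonneg hterm))
      simp only [hab, IsEmpty.forall_iff, implies_true, if_true, ne_eq, not_false_eq_true,
        Finset.filter_true]
      rw [sq, Finset.sum_mul_sum]
  have hC := sq_mul_measureReal_forall_notMem_le ν A hA
  set F := ν.real {ω | ∀ a, ω ∉ A a} with hF
  set m : ℝ := ∏ s, (M s : ℝ) with hm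
  have hm0 : 0 < m := Finset.prod_pos fun s _ => by exact_mod_cast hM s
  have hcard : (Fintype.card (∀ s, Fin (M s)) : ℝ) = m := by
    simp [hm]
  have hsum : ∑ a, ν.real (A a) = m * Q := by
    simp [hA1, hm]
  have hsum2 : ∑ a, ∑ b, ν.real (A a ∩ A b) ≤ m ^ 2 * Q ^ 2 +
      ∑ D : Finset ι with D.Nonempty, m ^ 2 * (Q * R D) / ∏ s ∈ D, (M s : ℝ) := by
    calc ∑ a, ∑ b, ν.real (A a ∩ A b)
        ≤ ∑ a : ∀ s, Fin (M s), ∑ b : ∀ s, Fin (M s), (Q ^ 2 +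
          ∑ D : Finset ι with D.Nonempty, if ∀ s ∈ D, a s = b s then Q * R D else 0) :=
          Finset.sum_le_sum fun a _ => Finset.sum_le_sum fun b _ => hA2 a b
      _ = ∑ a : ∀ s, Fin (M s), (m * Q ^ 2 +
          ∑ D : Finset ι with D.Nonempty, m * (Q * R D) / ∏ s ∈ D, (M s : ℝ)) := by
          refine Finset.sum_congr rfl fun a _ => ?_
          rw [Finset.sum_add_distrib, Finset.sum_comm]
          congr 1
          · rw [Finset.sum_const, Finset.card_univ, nsmul_eq_mul, hcard]
          · refine Finset.sum_congr rfl fun D _ => ?_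
            have hD0 : (∏ s ∈ D, (M s : ℝ)) ≠ 0 :=
              Finset.prod_ne_zero_iff.2 fun s _ => by exact_mod_cast (hM s).ne'
            rw [← Finset.sum_filter, Finset.sum_const, nsmul_eq_mul, hm, ← card_agree_mul a D]
            field_simp
      _ = _ := by
          rw [Finset.sum_const, Finset.card_univ, nsmul_eq_mul, hcard, mul_add, Finset.mul_sum]
          congr 1
          · ring
          · refine Finset.sum_congr rfl fun D _ => ?_
            ring
  rw [hsum] at hC
  have hmain : (m * Q) ^ 2 * F ≤
      (m * Q) ^ 2 * ∑ D : Finset ι with D.Nonempty, R D / (Q * ∏ s ∈ D, (M s : ℝ)) := by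
    refine (hC.trans (sub_le_sub_right hsum2 _)).trans (le_of_eq ?_)
    rw [mul_pow, add_sub_cancel_left, Finset.mul_sum]
    refine Finset.sum_congr rfl fun D _ => ?_
    field_simp
  have := le_of_mul_le_mul_left hmain (by positivity)
  refine this.trans (Finset.sum_le_sum fun D hD => ?_)
  have hD1 : 0 < ∏ s ∈ D, (M s : ℝ) := Finset.prod_pos fun s _ => by exact_mod_cast hM s
  have := hR0 D (Finset.mem_filter.1 hD).2
  gcongr

/-! ### The conditional mutual covering lemma -/

/-- The logarithm of the ratio of `∏_{s ∈ T} k s` to the conditional pmf of `q` given `f`. -/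
def logRatio {ι C F : Type*} {β : ι → Type*} (q : PMF (C × ∀ s, β s)) (k : ∀ s, C → β s → ℝ)
    (T : Finset ι) (f : (C × ∀ s, β s) → F) (y : C × ∀ s, β s) : ℝ :=
  ∑ s ∈ T, Real.logb 2 (k s y.1 (y.2 s)) -
    Real.logb 2 ((q y).toReal / (q.map f (f y)).toReal)

lemma condMass_self {B C : Type*} (q : PMF B) (f : B → C) (b : B) :
    condMass q f (f b) b = (q b).toReal / (q.map f (f b)).toReal := by
  simp [condMass]

lemma condMass_self_pos {B C : Type*} (q : PMF B) (f : B → C) {b : B} (hb : q b ≠ 0) :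
    0 < condMass q f (f b) b := by
  rw [condMass_self]
  exact div_pos (toReal_pos_of_ne_zero _ hb) (toReal_pos_of_ne_zero _ (map_apply_ne_zero q f hb))

lemma rpow_sum {κ : Type*} (s : Finset κ) (g : κ → ℝ) :
    (2 : ℝ) ^ (∑ i ∈ s, g i) = ∏ i ∈ s, (2 : ℝ) ^ g i := by
  classical
  induction s using Finset.induction_on with
  | empty => simp
  | insert a s ha ih => rw [Finset.sum_insert ha, Finset.prod_insert ha,
      Real.rpow_add (by norm_num), ih]

/-- Change of measure, coordinate by coordinate. Nonzero mass of each `y i` makes the kernels and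
the conditional masses positive, so that exponentiating inverts the logarithms. -/
lemma prod_kernel_eq {ι C F : Type*} {β : ι → Type*} (q : PMF (C × ∀ s, β s))
    (k : ∀ s, C → β s → ℝ) (hk : ∀ y, q y ≠ 0 → ∀ s, 0 < k s y.1 (y.2 s))
    (T : Finset ι) (f : (C × ∀ s, β s) → F) {n : ℕ} (y : Fin n → C × ∀ s, β s)
    (hy : ∀ i, q (y i) ≠ 0) :
    ∏ s ∈ T, ∏ i, k s (y i).1 ((y i).2 s) =
      (∏ i, condMass q f (f (y i)) (y i)) * 2 ^ ∑ i, logRatio q k T f (y i) := by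
  rw [Finset.prod_comm, rpow_sum, ← Finset.prod_mul_distrib]
  refine Finset.prod_congr rfl fun i _ => ?_
  have h2 : (0 : ℝ) < 2 := by norm_num
  have h1 : (2 : ℝ) ≠ 1 := by norm_num
  rw [logRatio, Real.rpow_sub h2, rpow_sum, ← condMass_self,
    Real.rpow_logb h2 h1 (condMass_self_pos q f (hy i)),
    mul_div_cancel₀ _ (condMass_self_pos q f (hy i)).ne']
  exact Finset.prod_congr rfl fun s _ => (Real.rpow_logb h2 h1 (hk _ (hy i) s)).symm

open Classical in
/-- The fluctuation of the exponents of typical sequences, per unit of `ε`. -/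
def slack {ι C : Type*} {β : ι → Type*} [Fintype ι] [Fintype C] [∀ s, Fintype (β s)]
    (q : PMF (C × ∀ s, β s)) (k : ∀ s, C → β s → ℝ) (D : Finset ι) : ℝ :=
  mean q (fun y => |logRatio q k Finset.univ Prod.fst y|) +
    mean q (fun y => |logRatio q k (Finset.univ.filter (· ∉ D))
      (fun y => (D.restrict y.2, y.1)) y|)

lemma slack_nonneg {ι C : Type*} {β : ι → Type*} [Fintype ι] [Fintype C] [∀ s, Fintype (β s)]
    (q : PMF (C × ∀ s, β s)) (k : ∀ s, C → β s → ℝ) (D : Finset ι) : 0 ≤ slack q k D := by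
  classical
  exact add_nonneg (mean_nonneg _ fun _ => abs_nonneg _) (mean_nonneg _ fun _ => abs_nonneg _)

-- The kernels outside `D` cancel, and the quotient of the two conditional masses is the conditional
-- probability of the `D` part given the first component. The joint entropy of `D` in the rate
-- condition originates here.
open Classical in
lemma mean_logRatio_sub {ι C : Type*} {β : ι → Type*} [Fintype ι] [Fintype C]
    [∀ s, Fintype (β s)] (q : PMF (C × ∀ s, β s)) (k : ∀ s, C → β s → ℝ) (D : Finset ι) :
    mean q (logRatio q k Finset.univ Prod.fst) -
      mean q (logRatio q k (Finset.univ.filter (· ∉ D)) (fun y => (D.restrict y.2, y.1))) =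
    ∑ s ∈ D, mean q (fun y => Real.logb 2 (k s y.1 (y.2 s))) -
      mean q (fun y => Real.logb 2
        (condProb q (fun y => D.restrict y.2) Prod.fst (D.restrict y.2) y.1)) := by
  rw [← mean_sum, ← mean_sub, ← mean_sub]
  refine mean_congr q fun y hy => ?_
  have h0 := (toReal_pos_of_ne_zero _ hy).ne'
  have h1 := (toReal_pos_of_ne_zero _ (map_apply_ne_zero q Prod.fst hy)).ne'
  have h2 := (toReal_pos_of_ne_zero _ (map_apply_ne_zero q (fun y => (D.restrict y.2, y.1)) hy)).ne'
  have hsplit := Finset.sum_filter_add_sum_filter_not Finset.univ (· ∈ D)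
    (fun s => Real.logb 2 (k s y.1 (y.2 s)))
  rw [Finset.filter_univ_mem] at hsplit
  simp only [logRatio, condProb]
  rw [Real.logb_div h0 h1, Real.logb_div h0 h2, Real.logb_div h2 h1, ← hsplit]
  ring

/-- The sequence of tuples formed by `c` and the sequences `x s`. -/
def zipSeq {ι C : Type*} {β : ι → Type*} {n : ℕ} (c : Fin n → C) (x : ∀ s, Fin n → β s) :
    Fin n → C × ∀ s, β s := fun i => (c i, fun s => x s i)

lemma zipSeq_injective {ι C : Type*} {β : ι → Type*} {n : ℕ} (c : Fin n → C) :
    Function.Injective (zipSeq (β := β) c) := by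
  intro x x' h
  funext s i
  exact congrFun (congrArg Prod.snd (congrFun h i)) s

open Classical in
/-- The product of the kernels gives the typical sequences a probability that is not too small. -/
lemma le_sum_prod_kernel {ι C : Type*} {β : ι → Type*} [Fintype ι] [Fintype C]
    [∀ s, Fintype (β s)] (q : PMF (C × ∀ s, β s)) (k : ∀ s, C → β s → ℝ)
    (hk : ∀ y, q y ≠ 0 → ∀ s, 0 < k s y.1 (y.2 s)) (ε : ℝ) {n : ℕ} (c : Fin n → C)
    (h1 : 1 / 2 ≤ ∑ y : Fin n → C × ∀ s, β s with Typical q ε y,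
      ∏ i, condMass q Prod.fst (c i) (y i)) :
    1 / 2 * 2 ^ (n * (mean q (logRatio q k Finset.univ Prod.fst) -
        ε * mean q fun y => |logRatio q k Finset.univ Prod.fst y|)) ≤
      ∑ x with Typical q ε (zipSeq c x), ∏ s, ∏ i, k s (c i) (x s i) := by
  set g₀ := logRatio q k Finset.univ Prod.fst
  -- The conditional law given `c` charges only sequences with first component `c`, and these are
  -- the values of `zipSeq c`.
  have e1 : ∑ y : Fin n → C × ∀ s, β s with Typical q ε y, ∏ i, condMass q Prod.fst (c i) (y i)
      = ∑ x with Typical q ε (zipSeq c x), ∏ i, condMass q Prod.fst (c i) (zipSeq c x i) := by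
    symm
    rw [← Finset.sum_image (f := fun y => ∏ i, condMass q Prod.fst (c i) (y i))
      (s := Finset.univ.filter (fun x => Typical q ε (zipSeq c x))) (g := zipSeq c)
      (zipSeq_injective c).injOn]
    refine Finset.sum_subset ?_ ?_
    · intro y hy
      obtain ⟨x, hx, rfl⟩ := Finset.mem_image.1 hy
      exact Finset.mem_filter.2 ⟨Finset.mem_univ _, (Finset.mem_filter.1 hx).2⟩
    · intro y hy hy'
      by_contra hne
      apply hy'
      have hyc : ∀ i, (y i).1 = c i := by
        intro i
        by_contra hi
        exact hne (Finset.prod_eq_zero (Finset.mem_univ i) (if_neg hi))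
      have : y = zipSeq c (fun s i => (y i).2 s) := by
        funext i
        exact Prod.ext (hyc i) rfl
      refine Finset.mem_image.2 ⟨fun s i => (y i).2 s, ?_, this.symm⟩
      refine Finset.mem_filter.2 ⟨Finset.mem_univ _, ?_⟩
      rw [← this]
      exact (Finset.mem_filter.1 hy).2
  rw [e1] at h1
  calc 1 / 2 * 2 ^ (n * (mean q g₀ - ε * mean q fun y => |g₀ y|))
      ≤ (∑ x with Typical q ε (zipSeq c x), ∏ i, condMass q Prod.fst (c i) (zipSeq c x i)) *
        2 ^ (n * (mean q g₀ - ε * mean q fun y => |g₀ y|)) := by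
        gcongr
    _ ≤ _ := by
        rw [Finset.sum_mul]
        refine Finset.sum_le_sum fun x hx => ?_
        have hx' : Typical q ε (zipSeq c x) := (Finset.mem_filter.1 hx).2
        have e := prod_kernel_eq q k hk Finset.univ Prod.fst (zipSeq c x) hx'.apply_ne_zero
        change _ ≤ ∏ s, ∏ i, k s (zipSeq c x i).1 ((zipSeq c x i).2 s)
        rw [e]
        refine mul_le_mul_of_nonneg_left ?_
          (Finset.prod_nonneg fun i _ => condMass_nonneg _ _ _ _)
        refine Real.rpow_le_rpow_of_exponent_le (by norm_num) ?_
        have := (abs_le.1 (hx'.abs_sum_sub_le g₀)).1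
        linarith

open Classical in
/-- Given the sequences with indices in `D`, the product of the other kernels gives the typical
sequences a probability that is not too large. -/
lemma sum_prod_kernel_le {ι C : Type*} {β : ι → Type*} [Fintype ι] [Fintype C]
    [∀ s, Fintype (β s)] (q : PMF (C × ∀ s, β s)) (k : ∀ s, C → β s → ℝ)
    (hk : ∀ y, q y ≠ 0 → ∀ s, 0 < k s y.1 (y.2 s)) (ε : ℝ) {n : ℕ} (c : Fin n → C)
    (D : Finset ι) (x : ∀ s, Fin n → β s) (hx : Typical q ε (zipSeq c x)) :
    ∑ y with Typical q ε (zipSeq c y) ∧ ∀ s ∈ D, y s = x s,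
        ∏ s with s ∉ D, ∏ i, k s (c i) (y s i) ≤
      2 ^ (n * (mean q (logRatio q k (Finset.univ.filter (· ∉ D)) fun y => (D.restrict y.2, y.1)) +
        ε * mean q fun y => |logRatio q k (Finset.univ.filter (· ∉ D))
          (fun y => (D.restrict y.2, y.1)) y|)) := by
  set f : (C × ∀ s, β s) → (∀ s : D, β s) × C := fun y => (D.restrict y.2, y.1)
  set g := logRatio q k (Finset.univ.filter (· ∉ D)) f
  set R : ℝ := 2 ^ (n * (mean q g + ε * mean q fun y => |g y|))
  have hone : ∑ y : Fin n → C × ∀ s, β s, ∏ i, condMass q f (f (zipSeq c x i)) (y i) = 1 := by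
    rw [sum_prod_pi fun i => condMass q f (f (zipSeq c x i))]
    exact Finset.prod_eq_one fun i _ =>
      sum_condMass q f (map_apply_ne_zero q f (Typical.apply_ne_zero hx i))
  -- The sequences `zipSeq c y` are distinct, so their conditional masses sum to at most the total
  -- mass one.
  have hle : ∑ y with Typical q ε (zipSeq c y) ∧ ∀ s ∈ D, y s = x s,
      ∏ i, condMass q f (f (zipSeq c x i)) (zipSeq c y i) ≤ 1 := by
    rw [← hone, ← Finset.sum_image (f := fun y => ∏ i, condMass q f (f (zipSeq c x i)) (y i))
      (g := zipSeq c)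
      (zipSeq_injective c).injOn]
    exact Finset.sum_le_sum_of_subset_of_nonneg (Finset.subset_univ _) fun y _ _ =>
      Finset.prod_nonneg fun i _ => condMass_nonneg _ _ _ _
  refine le_trans ?_ ((mul_le_mul_of_nonneg_right hle (by positivity : 0 ≤ R)).trans
    (one_mul _).le)
  rw [Finset.sum_mul]
  refine Finset.sum_le_sum fun y hy => ?_
  obtain ⟨hyτ, hyx⟩ := (Finset.mem_filter.1 hy).2
  have hy' : Typical q ε (zipSeq c y) := hyτ
  have e := prod_kernel_eq q k hk (Finset.univ.filter (· ∉ D)) f (zipSeq c y) hy'.apply_ne_zero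
  have hf : ∀ i, f (zipSeq c y i) = f (zipSeq c x i) := by
    intro i
    refine Prod.ext ?_ rfl
    funext s
    exact congrFun (hyx s s.2) i
  change ∏ s with s ∉ D, ∏ i, k s (zipSeq c y i).1 ((zipSeq c y i).2 s) ≤ _
  rw [e]
  simp_rw [hf]
  refine mul_le_mul_of_nonneg_left ?_
    (Finset.prod_nonneg fun i _ => condMass_nonneg _ _ _ _)
  refine Real.rpow_le_rpow_of_exponent_le (by norm_num) ?_
  have := (abs_le.1 (hy'.abs_sum_sub_le g)).2
  linarith

open Classical in
/-- The exponent at which the codewords with indices in `D` outnumber what is needed to cover. -/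
def gap {ι C : Type*} {β : ι → Type*} [Fintype ι] [Fintype C] [∀ s, Fintype (β s)]
    (q : PMF (C × ∀ s, β s)) (k : ∀ s, C → β s → ℝ) (ε : ℝ) (r : ι → ℝ) (D : Finset ι) : ℝ :=
  ∑ s ∈ D, r s + (mean q (logRatio q k Finset.univ Prod.fst) -
      mean q (logRatio q k (Finset.univ.filter (· ∉ D)) (fun y => (D.restrict y.2, y.1)))) -
    ε * slack q k D

-- The second moment bound with both exponential estimates inserted; the factor `2` is the inverse
-- of the `1 / 2` from conditional typicality.
open Classical in
lemma measureReal_forall_not_typical_le {ι C : Type*} {β : ι → Type*} [Fintype ι] [Fintype C]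
    [∀ s, Fintype (β s)] [∀ s, MeasurableSpace (β s)] [∀ s, MeasurableSingletonClass (β s)]
    (q : PMF (C × ∀ s, β s)) (k : ∀ s, C → β s → ℝ)
    (hk : ∀ y, q y ≠ 0 → ∀ s, 0 < k s y.1 (y.2 s)) (ε : ℝ) (r : ι → ℝ)
    {n : ℕ} (c : Fin n → C)
    (hc : 1 / 2 ≤ ∑ y : Fin n → C × ∀ s, β s with Typical q ε y,
      ∏ i, condMass q Prod.fst (c i) (y i))
    (M : ι → ℕ) (hM : ∀ s, (2 : ℝ) ^ ((n : ℝ) * r s) ≤ M s)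
    {Ω : Type*} [MeasurableSpace Ω] (ν : Measure Ω) [IsProbabilityMeasure ν]
    (X : ∀ s, Fin (M s) → Ω → Fin n → β s) (hX : ∀ s a, Measurable (X s a))
    (hlaw : ∀ s a x, ν.real {ω | X s a ω = x} = ∏ i, k s (c i) (x i))
    (hpair : ∀ s a b, a ≠ b → IndepFun (X s a) (X s b) ν)
    (hind : iIndepFun (fun s ω a => X s a ω) ν) :
    ν.real {ω | ∀ a : ∀ s, Fin (M s), ¬ Typical q ε (zipSeq c fun s => X s (a s) ω)} ≤
      ∑ D : Finset ι with D.Nonempty, 2 * (2 : ℝ) ^ (-(n * gap q k ε r D)) := by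
  have hMpos : ∀ s, 0 < M s := fun s => by
    have := (Real.rpow_pos_of_pos (by norm_num : (0 : ℝ) < 2) ((n : ℝ) * r s)).trans_le (hM s)
    exact_mod_cast this
  have h2 : (0 : ℝ) < 2 := by norm_num
  refine (measureReal_forall_not_le hMpos ν X hX (fun s x => ∏ i, k s (c i) (x i)) hlaw hpair hind
    (fun x => Typical q ε (zipSeq c x)) _ (mul_pos (by norm_num) (Real.rpow_pos_of_pos h2 _))
    (le_sum_prod_kernel q k hk ε c hc)
    (fun D => 2 ^ (n * (mean q (logRatio q k (Finset.univ.filter (· ∉ D))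
        fun y => (D.restrict y.2, y.1)) +
      ε * mean q fun y => |logRatio q k (Finset.univ.filter (· ∉ D))
        (fun y => (D.restrict y.2, y.1)) y|)))
    (fun D _ x hx => by convert sum_prod_kernel_le q k hk ε c D x hx)).trans
    (Finset.sum_le_sum fun D _ => ?_)
  have hMD : (2 : ℝ) ^ (n * ∑ s ∈ D, r s) ≤ ∏ s ∈ D, (M s : ℝ) := by
    rw [Finset.mul_sum, rpow_sum]
    exact Finset.prod_le_prod (fun s _ => by positivity) fun s _ => hM s
  rw [gap, slack]
  generalize mean q (logRatio q k Finset.univ Prod.fst) = m₀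
  generalize mean q (fun y => |logRatio q k Finset.univ Prod.fst y|) = v₀
  generalize mean q (logRatio q k (Finset.univ.filter (· ∉ D))
    (fun y => (D.restrict y.2, y.1))) = m₁
  generalize mean q (fun y => |logRatio q k (Finset.univ.filter (· ∉ D))
    (fun y => (D.restrict y.2, y.1)) y|) = v₁
  calc (2 : ℝ) ^ (n * (m₁ + ε * v₁)) / (1 / 2 * 2 ^ (n * (m₀ - ε * v₀)) * ∏ s ∈ D, (M s : ℝ))
      ≤ 2 ^ (n * (m₁ + ε * v₁)) / (1 / 2 * 2 ^ (n * (m₀ - ε * v₀)) * 2 ^ (n * ∑ s ∈ D, r s)) := by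
        gcongr
    _ = 2 * 2 ^ (n * (m₁ + ε * v₁) - (n * (m₀ - ε * v₀) + n * ∑ s ∈ D, r s)) := by
        rw [Real.rpow_sub h2, Real.rpow_add h2]
        field_simp
    _ = _ := by
        congr 2
        ring

open Classical in
/-- Conditional mutual covering lemma: codewords drawn independently from the kernels `k s` given a
typical sequence `c` contain, with high probability, a tuple jointly typical with `c`. -/
lemma exists_covering_bound {ι C : Type*} {β : ι → Type*} [Fintype ι] [Fintype C]
    [∀ s, Fintype (β s)] [∀ s, MeasurableSpace (β s)] [∀ s, MeasurableSingletonClass (β s)]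
    (q : PMF (C × ∀ s, β s)) (k : ∀ s, C → β s → ℝ)
    (hk : ∀ y, q y ≠ 0 → ∀ s, 0 < k s y.1 (y.2 s))
    {ε ε' : ℝ} (hε : ε' < ε) (r : ι → ℝ)
    (hr : ∀ D : Finset ι, D.Nonempty → ∑ s ∈ D, r s >
      -∑ s ∈ D, mean q (fun y => Real.logb 2 (k s y.1 (y.2 s))) +
        mean q (fun y => Real.logb 2
          (condProb q (fun y => D.restrict y.2) Prod.fst (D.restrict y.2) y.1)) +
        ε * slack q k D) :
    ∃ bd : ℕ → ℝ, Tendsto bd atTop (𝓝 0) ∧ ∀ᶠ n : ℕ in atTop, ∀ c : Fin n → C,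
      Typical (q.map Prod.fst) ε' c → ∀ M : ι → ℕ, (∀ s, (2 : ℝ) ^ ((n : ℝ) * r s) ≤ M s) →
      ∀ (Ω : Type*) [MeasurableSpace Ω] (ν : Measure Ω) [IsProbabilityMeasure ν]
        (X : ∀ s, Fin (M s) → Ω → Fin n → β s), (∀ s a, Measurable (X s a)) →
        (∀ s a x, ν.real {ω | X s a ω = x} = ∏ i, k s (c i) (x i)) →
        (∀ s a b, a ≠ b → IndepFun (X s a) (X s b) ν) →
        iIndepFun (fun s ω a => X s a ω) ν →
        ν.real {ω | ∀ a : ∀ s, Fin (M s),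
          ¬ Typical q ε (zipSeq c fun s => X s (a s) ω)} ≤ bd n := by
  -- The bound depends on `n` alone, not on `c`, `M` or the measure. This uniformity allows
  -- averaging over the conditioning atoms.
  refine ⟨fun n => ∑ D : Finset ι with D.Nonempty, 2 * (2 : ℝ) ^ (-(n * gap q k ε r D)), ?_, ?_⟩
  · rw [show (0 : ℝ) = ∑ D : Finset ι with D.Nonempty, 2 * 0 by simp]
    refine tendsto_finsetSum _ fun D hD => Tendsto.const_mul _ ?_
    have hp : 0 < gap q k ε r D := by
      have h1 := hr D (Finset.mem_filter.1 hD).2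
      rw [gap, mean_logRatio_sub q k D]
      linarith
    generalize gap q k ε r D = η at hp
    have : ∀ n : ℕ, (2 : ℝ) ^ (-(n * η)) = ((2 : ℝ) ^ (-η)) ^ n := by
      intro n
      rw [← Real.rpow_natCast, ← Real.rpow_mul (by norm_num)]
      congr 1
      ring
    simp_rw [this]
    exact tendsto_pow_atTop_nhds_zero_of_lt_one (by positivity)
      (Real.rpow_lt_one_of_one_lt_of_neg (by norm_num) (by linarith))
  filter_upwards [eventually_half_le_sum_condMass q Prod.fst hε] with n hn
  intro c hc M hM Ω _ ν _ X hX hlaw hpair hind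
  exact measureReal_forall_not_typical_le q k hk ε r c (hn c hc) M hM ν X hX hlaw hpair hind

/-! ### One level of the hierarchy -/

lemma measurableSet_setOf_comp {Ω E : Type*} [MeasurableSpace Ω] [Finite E] [MeasurableSpace E]
    [MeasurableSingletonClass E] {f : Ω → E} (hf : Measurable f) (P : E → Prop) :
    MeasurableSet {ω | P (f ω)} :=
  hf (Set.toFinite {x | P x}).measurableSet

/-- Law of total probability over the atoms of a discrete variable `V`: a bound that holds
conditionally on every atom that meets `G` holds on `G`. -/
lemma measureReal_inter_le_of_atoms {Ω F : Type*} [MeasurableSpace Ω] [Finite F]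
    (μ : Measure Ω) [IsProbabilityMeasure μ] (V : Ω → F)
    (hV : ∀ v, MeasurableSet (V ⁻¹' {v})) (B G : Set Ω) {t : ℝ} (ht : 0 ≤ t)
    (h : ∀ ω ∈ G, μ (V ⁻¹' {V ω}) ≠ 0 →
      ∃ B', V ⁻¹' {V ω} ∩ B ⊆ B' ∧ (μ[|V ⁻¹' {V ω}]).real B' ≤ t) :
    μ.real (B ∩ G) ≤ t := by
  classical
  have := Fintype.ofFinite F
  set I : Finset F := Finset.univ.filter (· ∈ V '' G)
  have hsub : B ∩ G ⊆ ⋃ v ∈ I, V ⁻¹' {v} ∩ B := by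
    rintro ω ⟨hB, hG⟩
    exact Set.mem_biUnion (x := V ω)
      (Finset.mem_coe.2 (Finset.mem_filter.2 ⟨Finset.mem_univ _, ω, hG, rfl⟩)) ⟨rfl, hB⟩
  calc μ.real (B ∩ G) ≤ μ.real (⋃ v ∈ I, V ⁻¹' {v} ∩ B) :=
        measureReal_mono hsub (measure_ne_top _ _)
    _ ≤ ∑ v ∈ I, μ.real (V ⁻¹' {v} ∩ B) := measureReal_biUnion_finset_le _ _
    _ ≤ ∑ v ∈ I, t * μ.real (V ⁻¹' {v}) := by
        refine Finset.sum_le_sum fun v hv => ?_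
        obtain ⟨ω, hω, rfl⟩ := (Finset.mem_filter.1 hv).2
        by_cases h0 : μ (V ⁻¹' {V ω}) = 0
        · have : μ.real (V ⁻¹' {V ω} ∩ B) = 0 := by
            rw [measureReal_def, measure_mono_null Set.inter_subset_left h0]
            rfl
          rw [this]
          positivity
        · obtain ⟨B', hB', hle⟩ := h ω hω h0
          have hpos : 0 < μ.real (V ⁻¹' {V ω}) := ENNReal.toReal_pos h0 (measure_ne_top _ _)
          rw [measureReal_def, cond_apply (hV _), ENNReal.toReal_mul, ENNReal.toReal_inv,
            ← measureReal_def, ← measureReal_def, inv_mul_le_iff₀ hpos] at hle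
          refine (measureReal_mono ?_).trans (hle.trans (mul_comm _ _).le)
          exact Set.subset_inter Set.inter_subset_left hB'
    _ ≤ ∑ v, t * μ.real (V ⁻¹' {v}) :=
        Finset.sum_le_sum_of_subset_of_nonneg (Finset.subset_univ _) fun _ _ _ => by positivity
    _ = t := by
        have hd : μ.real (⋃ v ∈ (Finset.univ : Finset F), V ⁻¹' {v}) =
            ∑ v, μ.real (V ⁻¹' {v}) := by
          refine measureReal_biUnion_finset ?_ fun v _ => hV v
          intro a _ b _ hab
          exact Disjoint.preimage V (Set.disjoint_singleton.2 hab)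
        have hu : (⋃ v ∈ (Finset.univ : Finset F), V ⁻¹' {v}) = Set.univ := by
          ext ω
          simp
        rw [← Finset.mul_sum, ← hd, hu, probReal_univ, mul_one]

/-! ### Separating one level from the levels above it -/

variable {K : ℕ} {α : Sets K → Type*}

lemma mem_upper {l : ℕ} {T : Sets K} : T ∈ upper K l ↔ l < T.1.card := by simp [upper]

lemma mem_level {l : ℕ} {T : Sets K} : T ∈ level K l ↔ T.1.card = l := by simp [level]

lemma mem_above {S T : Sets K} : T ∈ above S ↔ S.1 ⊂ T.1 := by simp [above]

lemma above_subset_upper {l : ℕ} {S : Sets K} (hS : S ∈ level K l) : above S ⊆ upper K l := by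
  intro T hT
  rw [mem_upper, ← mem_level.1 hS]
  exact Finset.card_lt_card (mem_above.1 hT)

/-- The tuple of a level together with the tuple of the higher levels. -/
def levelPair (l : ℕ) (u : ∀ S, α S) :
    (∀ T : upper K l, α T) × ∀ S : level K l, α S :=
  ((upper K l).restrict u, (level K l).restrict u)

/-- The law according to which the codewords of a level are generated from the higher levels. -/
def levelKernel (p : PMF (∀ S, α S)) (l : ℕ) (S : level K l) (c : ∀ T : upper K l, α T)
    (b : α S) : ℝ :=
  condProb p (fun u => u S.1) (above S.1).restrict b
    (fun T => c ⟨T.1, above_subset_upper S.2 T.2⟩)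

/-- The tuple of the levels `l, …, K` formed from its parts. -/
def joinLevel (l : ℕ) (y : (∀ T : upper K l, α T) × ∀ S : level K l, α S) :
    ∀ T : upper K (l - 1), α T := fun T =>
  if h : l < T.1.1.card then y.1 ⟨T.1, mem_upper.2 h⟩
  else y.2 ⟨T.1, mem_level.2 (by have := mem_upper.1 T.2; omega)⟩

lemma joinLevel_levelPair (l : ℕ) (u : ∀ S, α S) :
    joinLevel l (levelPair l u) = (upper K (l - 1)).restrict u := by
  funext T
  unfold joinLevel
  split_ifs <;> rfl

lemma levelKernel_pos (p : PMF (∀ S, α S)) (l : ℕ)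
    (y : (∀ T : upper K l, α T) × ∀ S : level K l, α S)
    (hy : p.map (levelPair l) y ≠ 0) (S : level K l) : 0 < levelKernel p l S y.1 (y.2 S) := by
  obtain ⟨u, hu, rfl⟩ := (PMF.mem_support_map_iff _ _ _).1 ((PMF.mem_support_iff _ _).2 hy)
  exact condProb_pos p (fun u => u S.1) (above S.1).restrict ((PMF.mem_support_iff _ _).1 hu)

lemma mean_logb_levelKernel [∀ S, Fintype (α S)] (p : PMF (∀ S, α S)) (l : ℕ) (S : level K l)
    [Fintype ((∀ T : upper K l, α T) × ∀ S : level K l, α S)] :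
    mean (p.map (levelPair l)) (fun y => Real.logb 2 (levelKernel p l S y.1 (y.2 S))) =
      -condEntropy p (fun u => u S.1) (above S.1).restrict := by
  rw [mean_map, condEntropy_eq_mean, neg_neg]
  rfl

lemma mean_logb_condProb_level [∀ S, Fintype (α S)] (p : PMF (∀ S, α S)) (l : ℕ)
    (D : Finset (level K l)) (J : Finset (Sets K))
    (hJ : J = D.map (Function.Embedding.subtype _))
    [Fintype ((∀ T : upper K l, α T) × ∀ S : level K l, α S)] :
    mean (p.map (levelPair l)) (fun y => Real.logb 2 (condProb (p.map (levelPair l))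
      (fun y => D.restrict y.2) Prod.fst (D.restrict y.2) y.1)) =
      -condEntropy p J.restrict (upper K l).restrict := by
  subst hJ
  rw [mean_map, condEntropy_eq_mean, neg_neg]
  refine mean_congr p fun u _ => ?_
  rw [condProb_map]
  congr 1
  -- Tuples indexed by `D` and by its image in `Sets K` have different types but determine the same
  -- atoms.
  refine condProb_congr p (fun u => D.restrict (levelPair l u).2)
    (D.map (Function.Embedding.subtype _)).restrict (fun u => (levelPair l u).1) u fun v => ?_
  constructor
  · intro h
    funext T
    obtain ⟨S, hS, hST⟩ := Finset.mem_map.1 T.2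
    have := congrFun h ⟨S, hS⟩
    obtain ⟨T, hT⟩ := T
    subst hST
    exact this
  · intro h
    funext S
    exact congrFun h ⟨S.1.1, Finset.mem_map.2 ⟨S.1, S.2, rfl⟩⟩

/-- The event that no choice of the indices makes the codewords of the levels above `l` jointly
typical. -/
def uncovered (p : PMF (∀ S, α S)) {r : Sets K → ℝ} {n : ℕ} {Ω : Type*}
    (U : ∀ S : Sets K, Index r n → Ω → Fin n → α S) (l : ℕ) (ε : ℝ) : Set Ω :=
  {ω | ∀ m, ¬ Typical (p.map (upper K l).restrict) ε
    (fun i => (upper K l).restrict fun S => U S m ω i)}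

/-- The ceiling in `ℕ` replaces a negative exponent by zero, which keeps the inequality, so rates of
any sign are allowed. -/
lemma rpow_le_numWords (r : Sets K → ℝ) (n : ℕ) {S : Sets K} (hS : S.1.card < K) :
    (2 : ℝ) ^ ((n : ℝ) * r S) ≤ numWords r n S := by
  have hne : S.1 ≠ Finset.univ := by
    intro h
    rw [h, Finset.card_univ, Fintype.card_fin] at hS
    exact lt_irrefl _ hS
  rw [numWords, if_neg hne, Nat.cast_pow, Nat.cast_ofNat, ← Real.rpow_natCast]
  exact Real.rpow_le_rpow_of_exponent_le (by norm_num) (Nat.le_ceil _)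

lemma numWords_pos (r : Sets K → ℝ) (n : ℕ) (S : Sets K) : 0 < numWords r n S := by
  unfold numWords
  split_ifs <;> positivity

/-- The codewords of the levels above `l`. -/
def wordsAbove {r : Sets K → ℝ} {n : ℕ} {Ω : Type*}
    (U : ∀ S : Sets K, Index r n → Ω → Fin n → α S) (l : ℕ) (ω : Ω) :
    ∀ T : upper K l, Index r n → Fin n → α T := fun T m => U T m ω

lemma preimage_wordsAbove {r : Sets K → ℝ} {n : ℕ} {Ω : Type*}
    (U : ∀ S : Sets K, Index r n → Ω → Fin n → α S) (l : ℕ) (ω : Ω) :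
    wordsAbove U l ⁻¹' {wordsAbove U l ω} = sameAbove U l ω := by
  ext ω'
  constructor
  · intro h T hT m
    exact congrFun (congrFun h ⟨T, mem_upper.2 hT⟩) m
  · intro h
    funext T m
    exact h T (mem_upper.1 T.2) m

/-! ### Covering one level of a random codebook -/

section Codebook

variable [NeZero K] [∀ S, MeasurableSpace (α S)]
  {p : PMF (∀ S, α S)} {r : Sets K → ℝ} {n : ℕ} {Ω : Type*} [MeasurableSpace Ω] {μ : Measure Ω}
  {UK : Ω → Fin n → α (whole K)} {U : ∀ S : Sets K, Index r n → Ω → Fin n → α S}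

lemma ne_whole {S : Sets K} (hS : S.1.card < K) : S ≠ whole K := by
  rintro rfl
  simp [whole] at hS

/-- A codeword reads its own index and those of larger sets only, so changing the index of a smaller
set leaves it alone. -/
lemma IsCodebook.update_eq (h : IsCodebook p r μ UK U) (m : Index r n) {S T : Sets K}
    (a : Fin (numWords r n S)) (hT : S.1.card < T.1.card) :
    U T (Function.update m S a) = U T m := by
  have hne : ∀ T : Sets K, S.1.card < T.1.card → T ≠ S := by
    rintro T hT rfl
    exact lt_irrefl _ hT
  refine h.index _ _ _ (Function.update_of_ne (hne T hT) _ _) fun T' hT' => ?_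
  exact Function.update_of_ne (hne T' (hT.trans hT')) _ _

lemma IsCodebook.measurable_wordsAbove (h : IsCodebook p r μ UK U) (l : ℕ) :
    Measurable (wordsAbove U l) :=
  measurable_pi_iff.2 fun T => measurable_pi_iff.2 fun m => h.measurable T m

/-- On an atom on which the codewords of the levels above `l` can be made typical, the codewords
of level `l` can be chosen so that the levels from `l` on remain typical, except with the
probability that a codebook drawn from `levelKernel` fails to cover. -/
lemma IsCodebook.atom_bound [∀ S, Fintype (α S)] (h : IsCodebook p r μ UK U)
    [IsProbabilityMeasure μ] {l : ℕ}
    (hl : 1 ≤ l) (hlK : l < K) {ε ε' t : ℝ}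
    (H : ∀ c : Fin n → ∀ T : upper K l, α T,
      Typical ((p.map (levelPair l)).map Prod.fst) ε' c →
      ∀ M : level K l → ℕ, (∀ S, (2 : ℝ) ^ ((n : ℝ) * r S.1) ≤ M S) →
      ∀ (ν : Measure Ω) [IsProbabilityMeasure ν]
        (X : ∀ S : level K l, Fin (M S) → Ω → Fin n → α S), (∀ S a, Measurable (X S a)) →
        (∀ S a x, ν.real {ω | X S a ω = x} = ∏ i, levelKernel p l S (c i) (x i)) →
        (∀ S a b, a ≠ b → IndepFun (X S a) (X S b) ν) →
        iIndepFun (fun S ω a => X S a ω) ν →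
        ν.real {ω | ∀ a : ∀ S, Fin (M S),
          ¬ Typical (p.map (levelPair l)) ε (zipSeq c fun S => X S (a S) ω)} ≤ t)
    (ω : Ω) (hω : ω ∈ (uncovered p U l ε')ᶜ) (h0 : μ (sameAbove U l ω) ≠ 0) :
    ∃ B', sameAbove U l ω ∩ uncovered p U (l - 1) ε ⊆ B' ∧ (μ[|sameAbove U l ω]).real B' ≤ t := by
  obtain ⟨m, hm⟩ : ∃ m, Typical (p.map (upper K l).restrict) ε'
      (fun i => (upper K l).restrict fun S => U S m ω i) := by
    by_contra hcon
    push Not at hcon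
    exact hω hcon
  have : IsProbabilityMeasure (μ[|sameAbove U l ω]) := cond_isProbabilityMeasure h0
  have hcard : ∀ S : level K l, S.1.1.card = l := fun S => mem_level.1 S.2
  refine ⟨_, ?_, H (fun i => (upper K l).restrict fun S => U S m ω i) ?_
    (fun S => numWords r n S.1) (fun S => rpow_le_numWords r n ((hcard S).trans_lt hlK))
    (μ[|sameAbove U l ω]) (fun S a => U S.1 (Function.update m S.1 a))
    (fun S a => h.measurable _ _) ?_ ?_ (h.mutual_indep l hl hlK m ω h0)⟩
  · rintro ω' ⟨hω', hB⟩ a hT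
    -- The covering choice `a` on level `l` is combined with the typical choice `m` elsewhere. On
    -- the atom, the higher codewords at `ω'` are those at `ω`, and a codeword of level `l` ignores
    -- the other indices of its level.
    let m' : Index r n := fun T => if hT : T ∈ level K l then a ⟨T, hT⟩ else m T
    have hup : ∀ T : Sets K, l < T.1.card → m' T = m T := fun T hT =>
      dif_neg fun hT' => (mem_level.1 hT').not_gt hT
    have e1 : ∀ T : Sets K, l < T.1.card → U T m' ω' = U T m ω := fun T hT => by
      rw [h.index T m' m (hup T hT) fun T' hT' => hup T' (hT.trans hT'), hω' T hT m]
    have e2 : ∀ S : level K l, U S.1 m' = U S.1 (Function.update m S.1 (a S)) := fun S => by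
      refine h.index _ _ _ ?_ fun T hT => ?_
      · simp [m', S.2]
      · rw [hup T ((hcard S).symm.trans_lt hT), Function.update_of_ne]
        rintro rfl
        exact lt_irrefl _ hT
    refine hB m' ?_
    have hT' := hT.map (joinLevel l)
    rw [PMF.map_comp, show joinLevel l ∘ levelPair l = (upper K (l - 1)).restrict (π := α) from
      funext (joinLevel_levelPair l)] at hT'
    convert hT' using 1
    funext i T
    simp only [joinLevel, zipSeq]
    split_ifs with hlT
    · exact congrFun (e1 T hlT) i
    · exact congrFun (congrFun (e2 ⟨T.1, mem_level.2 (by have := mem_upper.1 T.2; omega)⟩) ω') i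
  · rw [PMF.map_comp]
    exact hm
  · intro S a x
    have hlaw := h.law S.1 (ne_whole ((hcard S).trans_lt hlK)) (Function.update m S.1 a) ω
      (by rwa [hcard S])
    have hU : ∀ T : above S.1, U T.1 (Function.update m S.1 a) = U T.1 m := fun T =>
      h.update_eq m a (Finset.card_lt_card (mem_above.1 T.2))
    simp only [hU, hcard S] at hlaw
    refine hlaw (fun i => ?_) x
    -- Typicality of the higher codewords guarantees that the conditional pmf in the law axiom is
    -- defined.
    have hi := map_apply_ne_zero _ (Finset.restrict₂ (π := α) (above_subset_upper S.2))
      (hm.apply_ne_zero i)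
    rw [PMF.map_comp] at hi
    exact hi
  · intro S a b hab
    have := h.pairwise S.1 (ne_whole ((hcard S).trans_lt hlK)) m ω (by rwa [hcard S]) a b hab
    rwa [hcard S] at this

lemma IsCodebook.measureReal_uncovered_le [∀ S, Fintype (α S)]
    [∀ S, MeasurableSingletonClass (α S)] (h : IsCodebook p r μ UK U) [IsProbabilityMeasure μ]
    {l : ℕ} (hl : 1 ≤ l) (hlK : l < K) {ε ε' t : ℝ} (ht : 0 ≤ t)
    (H : ∀ c : Fin n → ∀ T : upper K l, α T,
      Typical ((p.map (levelPair l)).map Prod.fst) ε' c →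
      ∀ M : level K l → ℕ, (∀ S, (2 : ℝ) ^ ((n : ℝ) * r S.1) ≤ M S) →
      ∀ (ν : Measure Ω) [IsProbabilityMeasure ν]
        (X : ∀ S : level K l, Fin (M S) → Ω → Fin n → α S), (∀ S a, Measurable (X S a)) →
        (∀ S a x, ν.real {ω | X S a ω = x} = ∏ i, levelKernel p l S (c i) (x i)) →
        (∀ S a b, a ≠ b → IndepFun (X S a) (X S b) ν) →
        iIndepFun (fun S ω a => X S a ω) ν →
        ν.real {ω | ∀ a : ∀ S, Fin (M S),
          ¬ Typical (p.map (levelPair l)) ε (zipSeq c fun S => X S (a S) ω)} ≤ t) :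
    μ.real (uncovered p U (l - 1) ε) ≤ μ.real (uncovered p U l ε') + t := by
  have h1 : μ.real (uncovered p U (l - 1) ε ∩ (uncovered p U l ε')ᶜ) ≤ t := by
    refine measureReal_inter_le_of_atoms μ (wordsAbove U l)
      (fun v => h.measurable_wordsAbove l (measurableSet_singleton v)) _ _ ht fun ω hω h0 => ?_
    rw [preimage_wordsAbove] at h0 ⊢
    exact h.atom_bound hl hlK H ω hω h0
  calc μ.real (uncovered p U (l - 1) ε)
      ≤ μ.real (uncovered p U l ε' ∪ (uncovered p U (l - 1) ε ∩ (uncovered p U l ε')ᶜ)) := by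
        refine measureReal_mono (fun ω hω => ?_) (measure_ne_top _ _)
        by_cases h' : ω ∈ uncovered p U l ε'
        · exact Or.inl h'
        · exact Or.inr ⟨hω, h'⟩
    _ ≤ _ := (measureReal_union_le _ _).trans (by gcongr)

/-- The only set with more than `K - 1` elements is the whole one, so the tuple above level `K - 1`
is a relabelling of the given sequence, performed by `F`. -/
lemma IsCodebook.measureReal_uncovered_top_le [∀ S, Fintype (α S)]
    [∀ S, MeasurableSingletonClass (α S)] (h : IsCodebook p r μ UK U) [IsProbabilityMeasure μ]
    (ε : ℝ) :
    μ.real (uncovered p U (K - 1) ε) ≤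
      1 - μ.real {ω | Typical (p.map fun u => u (whole K)) ε (UK ω)} := by
  let m₀ : Index r n := fun S => ⟨0, numWords_pos r n S⟩
  have hUK : Measurable UK := by
    rw [← h.top m₀]
    exact h.measurable (whole K) m₀
  have hmeas : MeasurableSet {ω | Typical (p.map fun u => u (whole K)) ε (UK ω)} :=
    measurableSet_setOf_comp hUK _
  rw [← probReal_compl_eq_one_sub hmeas]
  have hw : ∀ T : upper K (K - 1), whole K = T.1 := by
    intro T
    have h1 := mem_upper.1 T.2
    have h2 : T.1.1.card ≤ K := by simpa using Finset.card_le_univ T.1.1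
    refine Subtype.ext (Finset.eq_univ_of_card _ ?_).symm
    rw [Fintype.card_fin]
    omega
  let F : α (whole K) → ∀ T : upper K (K - 1), α T := fun a T => hw T ▸ a
  have e : ∀ u : ∀ S, α S, F (u (whole K)) = (upper K (K - 1)).restrict u := by
    intro u
    funext T
    obtain ⟨T, hT⟩ := T
    have := hw ⟨T, hT⟩
    subst this
    rfl
  refine measureReal_mono (fun ω hω hT => hω m₀ ?_) (measure_ne_top _ _)
  have hT' : Typical (p.map fun u => u (whole K)) ε (UK ω) := hT
  have hT'' := hT'.map F
  rw [PMF.map_comp, show (F ∘ fun u : ∀ S, α S => u (whole K)) = (upper K (K - 1)).restrict from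
    funext e, ← h.top m₀] at hT''
  have e' : (fun i => (upper K (K - 1)).restrict fun S => U S m₀ ω i) =
      fun i => F (U (whole K) m₀ ω i) := funext fun i => (e fun S => U S m₀ ω i).symm
  rw [e']
  exact hT''

end Codebook

/-! ### A common fluctuation constant and the rate condition -/

/-- The total fluctuation of the exponents of all levels, per unit of `ε`. -/
def totalSlack [∀ S, Fintype (α S)] (p : PMF (∀ S, α S)) : ℝ :=
  ∑ l ∈ Finset.range K, ∑ D : Finset (level K l),
    slack (p.map (levelPair l)) (levelKernel p l) D

lemma slack_le_totalSlack [∀ S, Fintype (α S)] (p : PMF (∀ S, α S)) {l : ℕ} (hl : l < K)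
    (D : Finset (level K l)) :
    slack (p.map (levelPair l)) (levelKernel p l) D ≤ totalSlack p := by
  refine (Finset.single_le_sum (f := fun D => slack (p.map (levelPair l)) (levelKernel p l) D)
    (fun D _ => slack_nonneg _ _ D) (Finset.mem_univ D)).trans ?_
  exact Finset.single_le_sum (f := fun l => ∑ D : Finset (level K l),
    slack (p.map (levelPair l)) (levelKernel p l) D)
    (fun l _ => Finset.sum_nonneg fun D _ => slack_nonneg _ _ D) (Finset.mem_range.2 hl)

lemma totalSlack_nonneg [∀ S, Fintype (α S)] (p : PMF (∀ S, α S)) : 0 ≤ totalSlack p :=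
  Finset.sum_nonneg fun _ _ => Finset.sum_nonneg fun D _ => slack_nonneg _ _ D

/-- Translates the entropy form of the rate condition into the means required by the covering lemma;
`totalSlack` absorbs the slack of each particular `D`. -/
lemma rate_condition_level [∀ S, Fintype (α S)] (p : PMF (∀ S, α S)) {l : ℕ} (hl : l < K)
    {ε : ℝ} (hε : 0 < ε) (r : Sets K → ℝ)
    (hr : ∀ J ⊆ level K l, J.Nonempty → ∑ S ∈ J, r S >
      (∑ S ∈ J, condEntropy p (fun u => u S) (above S).restrict)
        - condEntropy p J.restrict (upper K l).restrict + ε * (1 + totalSlack p))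
    (D : Finset (level K l)) (hD : D.Nonempty)
    {_ : Fintype ((∀ T : upper K l, α T) × ∀ S : level K l, α S)} :
    ∑ S ∈ D, r S.1 >
      -∑ S ∈ D, mean (p.map (levelPair l))
          (fun y => Real.logb 2 (levelKernel p l S y.1 (y.2 S))) +
        mean (p.map (levelPair l)) (fun y => Real.logb 2 (condProb (p.map (levelPair l))
          (fun y => D.restrict y.2) Prod.fst (D.restrict y.2) y.1)) +
        ε * slack (p.map (levelPair l)) (levelKernel p l) D := by
  obtain ⟨J, hJ⟩ : ∃ J, J = D.map (Function.Embedding.subtype _) := ⟨_, rfl⟩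
  have hJl : J ⊆ level K l := by
    intro S hS
    rw [hJ] at hS
    obtain ⟨T, _, rfl⟩ := Finset.mem_map.1 hS
    exact T.2
  have hJsum : ∀ g : Sets K → ℝ, ∑ S ∈ J, g S = ∑ S ∈ D, g S.1 := fun g => by
    rw [hJ, Finset.sum_map]
    rfl
  have h := hr J hJl (hJ ▸ hD.map)
  rw [hJsum, hJsum] at h
  rw [mean_logb_condProb_level p l D J hJ]
  simp_rw [mean_logb_levelKernel]
  rw [Finset.sum_neg_distrib, neg_neg]
  have hs : ε * slack (p.map (levelPair l)) (levelKernel p l) D ≤ ε * (1 + totalSlack p) := by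
    have := slack_le_totalSlack p hl D
    gcongr
    linarith
  linarith

end HierCov

end

/-! ### Induction over the levels -/

theorem lemma1 {K : ℕ} [NeZero K] {α : HierCov.Sets K → Type*}
    [∀ S, Fintype (α S)] [∀ S, MeasurableSpace (α S)] [∀ S, MeasurableSingletonClass (α S)]
    (p : PMF (∀ S, α S)) :
    ∃ δ : ℝ → ℝ, (∀ e, 0 < e → 0 < δ e) ∧ Tendsto δ (𝓝[>] 0) (𝓝 0) ∧
      ∀ (ε : ℕ → ℝ), 0 < ε K → StrictAntiOn ε (Set.Icc 1 K) →
      ∀ (r : HierCov.Sets K → ℝ)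
        (Ω : ℕ → Type*) [∀ n, MeasurableSpace (Ω n)]
        (μ : ∀ n, Measure (Ω n)) [∀ n, IsProbabilityMeasure (μ n)]
        (UK : ∀ n, Ω n → Fin n → α (HierCov.whole K))
        (U : ∀ n, ∀ S : HierCov.Sets K, HierCov.Index r n → Ω n → Fin n → α S),
      (∀ n, HierCov.IsCodebook p r (μ n) (UK n) (U n)) →
      Tendsto (fun n => (μ n).real
        {ω | HierCov.Typical (p.map fun u => u (HierCov.whole K)) (ε K) (UK n ω)})
        atTop (𝓝 1) →
      (∀ l, 1 ≤ l → l < K → ∀ J ⊆ HierCov.level K l, J.Nonempty →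
        ∑ S ∈ J, r S >
          (∑ S ∈ J, HierCov.condEntropy p (fun u => u S) (HierCov.above S).restrict)
            - HierCov.condEntropy p J.restrict (HierCov.upper K l).restrict + δ (ε l)) →
      Tendsto (fun n => (μ n).real
        {ω | ∀ m : HierCov.Index r n,
          ¬ HierCov.Typical p (ε 1) (fun i S => U n S m ω i)})
        atTop (𝓝 0) := by
  -- The summand `1` keeps `δ` positive even if `totalSlack p` vanishes.
  refine ⟨fun e => e * (1 + HierCov.totalSlack p), fun e he => ?_, ?_, ?_⟩
  · have := HierCov.totalSlack_nonneg p
    positivity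
  · have : Tendsto (fun e : ℝ => e * (1 + HierCov.totalSlack p)) (𝓝 0) (𝓝 0) := by
      simpa using (tendsto_id (α := ℝ) (x := 𝓝 0)).mul_const (1 + HierCov.totalSlack p)
    exact this.mono_left nhdsWithin_le_nhds
  intro ε hεK hanti r Ω _ μ _ UK U hU hUK hr
  -- After `d` steps the levels `K - d, …, K` are covered with tolerance `ε (K - d)`.
  have hlevels : ∀ d, d < K → Tendsto (fun n => (μ n).real
      (HierCov.uncovered p (U n) (K - 1 - d) (ε (K - d)))) atTop (𝓝 0) := by
    intro d
    induction d with
    | zero =>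
      intro _
      have h1 : Tendsto (fun n => 1 - (μ n).real {ω | HierCov.Typical
          (p.map fun u => u (HierCov.whole K)) (ε K) (UK n ω)}) atTop (𝓝 0) := by
        simpa using hUK.const_sub 1
      exact squeeze_zero (fun n => measureReal_nonneg)
        (fun n => (hU n).measureReal_uncovered_top_le (ε K)) h1
    | succ d ih =>
      intro hd
      have hl1 : 1 ≤ K - (d + 1) := by omega
      have hlK : K - (d + 1) < K := by omega
      have hlt : ε (K - d) < ε (K - (d + 1)) :=
        hanti ⟨hl1, hlK.le⟩ ⟨by omega, by omega⟩ (by omega)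
      have hpos : 0 < ε (K - (d + 1)) := hεK.trans (hanti ⟨hl1, hlK.le⟩ ⟨by omega, le_rfl⟩ hlK)
      have ih' := ih (by omega)
      rw [show K - 1 - d = K - (d + 1) by omega] at ih'
      rw [show K - 1 - (d + 1) = K - (d + 1) - 1 by omega]
      generalize K - (d + 1) = l at *
      obtain ⟨bd, hbd, hcov⟩ := HierCov.exists_covering_bound
        (p.map (HierCov.levelPair l)) (HierCov.levelKernel p l) (HierCov.levelKernel_pos p l) hlt
        (fun S => r S.1)
        (fun D hD => HierCov.rate_condition_level p hlK hpos r (hr l hl1 hlK) D hD)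
      -- The one-level estimate asks for a nonnegative bound, hence the absolute value.
      have hbd' : Tendsto (fun n => |bd n|) atTop (𝓝 0) := by simpa using hbd.abs
      refine squeeze_zero' (Eventually.of_forall fun n => measureReal_nonneg) ?_
        (by simpa using ih'.add hbd')
      filter_upwards [hcov] with n hn
      refine (hU n).measureReal_uncovered_le hl1 hlK (abs_nonneg _) ?_
      intro c hc M hM ν _ X hX hlaw hpair hind
      exact (hn c hc M hM (Ω n) ν X hX hlaw hpair hind).trans (le_abs_self _)
  have hK : 1 ≤ K := NeZero.one_le
  have h0 := hlevels (K - 1) (by omega)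
  rw [Nat.sub_self, show K - (K - 1) = 1 by omega] at h0
  refine squeeze_zero (fun n => measureReal_nonneg) (fun n => ?_) h0
  refine measureReal_mono (fun ω hω m hT => hω m ?_) (measure_ne_top _ _)
  -- All index sets are nonempty, so `upper K 0` contains every one, and typicality carries back to
  -- the full tuple along the relabelling.
  have hall : ∀ S : HierCov.Sets K, S ∈ HierCov.upper K 0 := fun S =>
    HierCov.mem_upper.2 (Finset.card_pos.2 S.2)
  have hT' := hT.map fun u S => u ⟨S, hall S⟩
  rw [PMF.map_comp] at hT'
  convert hT' using 1
  · exact (PMF.map_id p).symm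
  · rfl
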